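/- Throughout, a topological dynamical system $(X,T)$ is a compact metric space $X$ with a continuous surjection $T:X\to X$, and a measure on $X$ is a Borel probability measure; measures carry the weak* topology. For $x\in X$ and $n\ge 1$ let $\mu_{x[0,n]}=\frac1{n+1}\sum_{i=0}^{n}\delta_{T^ix}$. The point $x$ is generic for a measure $\mu$ if $\mu_{x[0,n]}\to\mu$ as $n\to\infty$, and quasi-generic for $\mu$ if $\mu$ is an accumulation point of the sequence $(\mu_{x[0,n]})_{n\ge1}$, i.e. $\mu_{x[0,n_k]}\to\mu$ for some increasing sequence $(n_k)_{k\ge1}$. A finite specification in $(X,T)$ consists of integers $0\le a_1\le b_1<a_2\le b_2<\dots<a_{N_1}\le b_{N_1}$ with $N_1\ge1$ and a function $\mathcal S:D\to X$ on $D=\bigcup_{N=1}^{N_1}[a_N,b_N]$ (intervals of integers) such that for each $N$ there is $x_N\in X$ with $\mathcal S(n)=T^n(x_N)$ for all $n\in[a_N,b_N]$. Its segment lengths are $l_N=b_N-a_N+1$ and its gaps are $g_N=a_{N+1}-b_N-1$. It is $\varepsilon$-shadowed by (the orbit of) $x\in X$ if $d(\mathcal S(n),T^nx)<\varepsilon$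 for all $n\in D$. The system $(X,T)$ has the weak specification property if for every $\varepsilon>0$ there is a function $M_\varepsilon:\mathbb N\to\mathbb N$ with $\lim_{l\to\infty}M_\varepsilon(l)/l=0$ such that every finite specification satisfying $g_N\ge M_\varepsilon(l_{N+1})$ for all $1\le N\le N_1-1$ is $\varepsilon$-shadowed by the orbit of some point of $X$. Theorem. Let $(X,T)$ and $(Y,S)$ be topological dynamical systems and let $\xi$ be an invariant measure on the product system $(X\times Y,T\times S)$ with marginals $\mu$ on $X$ and $\nu$ on $Y$. Assume that $(X,T)$ has the weak specification property and that $\mu$ is ergodic under $T$. Let $y\in Y$ be quasi-generic for $\nu$. Then there exists a point $x\in X$, generic for $\mu$, such that the pair $(x,y)$ is quasi-generic for $\xi$ (with respect to $T\times S$). -/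

import Mathlib

open MeasureTheory Filter Topology

namespace OrbitLift

section Empirical

variable {X : Type*} [MeasurableSpace X]

/-- The empirical measure of the orbit segment `(x, T x, …, T^n x)`: the normalized counting
measure, with `n + 1` point masses counted with multiplicity. -/
noncomputable def empiricalMeasure (T : X → X) (x : X) (n : ℕ) : ProbabilityMeasure X :=
  ⟨((n : ENNReal) + 1)⁻¹ • ∑ i ∈ Finset.range (n + 1), Measure.dirac (T^[i] x), by
    constructor
    have h : ((n : ENNReal) + 1)⁻¹ * ((n : ENNReal) + 1) = 1 :=
      ENNReal.inv_mul_cancel (by simp) (by simp)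
    simpa [Measure.finsetSum_apply] using h⟩

variable [TopologicalSpace X] [OpensMeasurableSpace X]

/-- `x` is generic for `μ`: its empirical measures converge to `μ` in the weak* topology. -/
def IsGeneric (T : X → X) (x : X) (μ : ProbabilityMeasure X) : Prop :=
  Tendsto (empiricalMeasure T x) atTop (𝓝 μ)

/-- `x` is quasi-generic for `μ`: `μ` is an accumulation (cluster) point, in the weak* topology,
of the sequence of empirical measures of `x`. -/
def IsQuasiGeneric (T : X → X) (x : X) (μ : ProbabilityMeasure X) : Prop :=
  MapClusterPt μ atTop (empiricalMeasure T x)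

end Empirical

/-- A finite specification: finitely many (at least one) integer intervals `[a i, b i]`, where
`i < numSegments`, with `a 0 ≤ b 0 < a 1 ≤ b 1 < …`, and a function `toFun` which coincides on each
interval with a piece of an orbit. Only the values of `a`, `b` at indices below `numSegments`, and
those of `toFun` on the union of the intervals, are meaningful. -/
structure FiniteSpecification {X : Type*} (T : X → X) where
  numSegments : ℕ
  one_le_numSegments : 1 ≤ numSegments
  a : ℕ → ℕ
  b : ℕ → ℕ
  a_le_b : ∀ i, i < numSegments → a i ≤ b i
  b_lt_a_succ : ∀ i, i + 1 < numSegments → b i < a (i + 1)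
  toFun : ℕ → X
  exists_orbit : ∀ i, i < numSegments →
    ∃ z : X, ∀ n ∈ Set.Icc (a i) (b i), toFun n = T^[n] z

namespace FiniteSpecification

variable {X : Type*} {T : X → X}

/-- The domain of a specification, the union of its intervals. -/
def domain (σ : FiniteSpecification T) : Set ℕ :=
  {n | ∃ i, i < σ.numSegments ∧ n ∈ Set.Icc (σ.a i) (σ.b i)}

/-- The length `b i - a i + 1` of the orbit segment number `i`. -/
def segmentLength (σ : FiniteSpecification T) (i : ℕ) : ℕ := σ.b i + 1 - σ.a i

/-- The gap `a (i + 1) - b i - 1` between the orbit segments number `i` and `i + 1`. -/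
def gap (σ : FiniteSpecification T) (i : ℕ) : ℕ := σ.a (i + 1) - (σ.b i + 1)

/-- The orbit of `x` `ε`-shadows the specification. -/
def ShadowedBy [MetricSpace X] (σ : FiniteSpecification T) (ε : ℝ) (x : X) : Prop :=
  ∀ n ∈ σ.domain, dist (σ.toFun n) (T^[n] x) < ε

end FiniteSpecification

/-- The weak specification property: for every `ε > 0` there is a function `M` with `M l / l → 0`
such that each finite specification, in which the gap before every orbit segment other than the
first is at least `M` of the length of that segment, is `ε`-shadowed by an orbit. -/
def WeakSpecification {X : Type*} [MetricSpace X] (T : X → X) : Prop :=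
  ∀ ε : ℝ, 0 < ε → ∃ M : ℕ → ℕ,
    Tendsto (fun l : ℕ => (M l : ℝ) / (l : ℝ)) atTop (𝓝 0) ∧
    ∀ σ : FiniteSpecification T,
      (∀ i, i + 1 < σ.numSegments → M (σ.segmentLength (i + 1)) ≤ σ.gap i) →
      ∃ x : X, σ.ShadowedBy ε x

end OrbitLift

namespace OrbitLift

open scoped RealInnerProductSpace

/-! The point `x` is built in stages. Each stage keeps the orbit segment found so far up to a small
error and prolongs it, by weak specification, with blocks of one fixed length `L` separated by gaps
of at least `g = M L`, small compared with `L`. The required gap depends only on the block after it,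
so a prefix of any length is continued at a bounded cost.

For genericity, blocks start in a closed set `G` of points whose `L`-step averages of the centered
test functions on `X` are small. The mean ergodic theorem makes `G` nearly full
(`eventually_measure_birkhoffSum_le`).

For the joint statistics, let `V(x, y')` be the `L`-step sum of a centered vector `F` of test
functions on `X × Y`. For every direction `c`, the `ν`-integral of the supremum over `x ∈ G` of `⟪c,
V(x, ·)⟫` is at least `∫ ⟪c, V⟫ dξ = 0` up to the defect of `G`, and quasi-genericity of `y`
transfers this bound to the orbit of `y` (`exists_forall_le_sum_inner`). Thus no direction separates
the achievable sums much from `0`, and `exists_selection` turns this into one choice of blocks with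
total sum `o(n)`.

`exists_orbit_extension` combines both, `exists_limit_orbit` iterates it with rapidly growing
lengths, and `tendsto_average_zero` gives convergence along all times. -/

/-! ### Shadowing a prefix followed by equally long blocks. -/

theorem exists_shadowing_blocks {X : Type*} [MetricSpace X] {T : X → X}
    (hT : Function.Surjective T) {ε : ℝ} {M : ℕ → ℕ}
    (hM : ∀ σ : FiniteSpecification T,
      (∀ i, i + 1 < σ.numSegments → M (σ.segmentLength (i + 1)) ≤ σ.gap i) →
      ∃ x : X, σ.ShadowedBy ε x)
    {L n₀ : ℕ} (hL : 0 < L) (hn₀ : 0 < n₀) (p : ℕ → ℕ) (hp₀ : n₀ + M L ≤ p 0)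
    (hp : ∀ i, p i + L + M L ≤ p (i + 1)) (z : ℕ → X) (x₀ : X) (N : ℕ) :
    ∃ x, (∀ i < n₀, dist (T^[i] x₀) (T^[i] x) < ε) ∧
      ∀ i < N, ∀ t < L, dist (T^[t] (z i)) (T^[p i + t] x) < ε := by
  classical
  have hmono : ∀ i j, i < j → p i + L ≤ p j := by
    intro i j hij
    induction j, hij using Nat.le_induction with
    | base => have := hp i; simp only [Nat.succ_eq_add_one]; omega
    | succ j _ ih => have := hp j; omega
  have hp_ge : ∀ i, n₀ ≤ p i := by
    intro i
    rcases Nat.eq_zero_or_pos i with rfl | hi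
    · omega
    · have := hmono 0 i hi; omega
  -- A specification reads the orbit at absolute times, so `z i` is pulled back by `T^[p i]`: the
  -- orbit of `w i` passes through `z i` at time `p i`.
  choose w hw using fun i => (hT.iterate (p i)) (z i)
  set u : ℕ → X := fun n =>
    if n < n₀ then T^[n] x₀
    else if h : ∃ i, p i ≤ n ∧ n < p i + L then T^[n] (w h.choose) else x₀ with hu
  have hu₀ : ∀ n < n₀, u n = T^[n] x₀ := fun n hn => by simp [hu, hn]
  have hu₁ : ∀ i n, p i ≤ n → n < p i + L → u n = T^[n] (w i) := by
    intro i n h1 h2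
    have hn : ¬ n < n₀ := by have := hp_ge i; omega
    have hex : ∃ i, p i ≤ n ∧ n < p i + L := ⟨i, h1, h2⟩
    have hch : hex.choose = i := by
      have hs := hex.choose_spec
      rcases lt_trichotomy hex.choose i with h | h | h
      · have := hmono _ _ h; omega
      · exact h
      · have := hmono _ _ h; omega
    simp only [hu, hn, if_false, hex, dif_pos, hch]
  let a : ℕ → ℕ := fun i => if i = 0 then 0 else p (i - 1)
  let b : ℕ → ℕ := fun i => if i = 0 then n₀ - 1 else p (i - 1) + L - 1
  let σ : FiniteSpecification T :=
    { numSegments := N + 1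
      one_le_numSegments := by omega
      a := a
      b := b
      a_le_b := by
        intro i _
        by_cases h : i = 0
        · simp [a, b, h]
        · simp only [a, b, h, if_false]; omega
      b_lt_a_succ := by
        intro i _
        by_cases h : i = 0
        · simp only [a, b, h, if_true]; simp; omega
        · have := hmono (i - 1) i (by omega)
          simp only [a, b, h, if_false, Nat.add_sub_cancel, Nat.succ_ne_zero]; omega
      toFun := u
      exists_orbit := by
        intro i _
        by_cases h : i = 0
        · refine ⟨x₀, fun n hn => hu₀ n ?_⟩
          simp only [a, b, h, if_true, Set.mem_Icc] at hn
          omega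
        · refine ⟨w (i - 1), fun n hn => ?_⟩
          simp only [a, b, h, if_false, Set.mem_Icc] at hn
          exact hu₁ _ _ hn.1 (by omega) }
  obtain ⟨x, hx⟩ := hM σ (by
    intro i _
    have h1 : σ.segmentLength (i + 1) = L := by
      simp only [FiniteSpecification.segmentLength, σ, a, b, Nat.succ_ne_zero, if_false,
        Nat.add_sub_cancel]
      omega
    rw [h1]
    simp only [FiniteSpecification.gap, σ, a, b, Nat.succ_ne_zero, if_false, Nat.add_sub_cancel]
    by_cases h : i = 0
    · simp only [h, if_true]; omega
    · have := hp (i - 1)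
      rw [Nat.sub_add_cancel (by omega)] at this
      simp only [h, if_false]; omega)
  refine ⟨x, fun i hi => ?_, fun i hi t ht => ?_⟩
  · have := hx i ⟨0, by simp [σ], by simp [σ, a, b]; omega⟩
    simpa [σ, hu₀ i hi] using this
  · have := hx (p i + t) ⟨i + 1, by simp [σ, hi], by
      simp only [σ, a, b, Nat.succ_ne_zero, if_false, Nat.add_sub_cancel, Set.mem_Icc]; omega⟩
    have h2 : T^[p i + t] (w i) = T^[t] (z i) := by
      rw [add_comm, Function.iterate_add_apply, hw]
    simpa [σ, hu₁ i (p i + t) (by omega) (by omega), h2] using this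


/-! ### From one choice per direction to a single choice. -/

/-- Take a choice nearly minimizing `‖s‖ ^ 2`. Changing one coordinate cannot gain much, so each
replacement advances in the direction `-s` by at most a constant. Summing over the coordinates
against the choice that `hκ` provides for `c = -s` bounds `‖s‖ ^ 2`. The error is linear in `Q`,
whereas the trivial bound on `‖s‖ ^ 2` is quadratic. -/
theorem exists_selection {E α : Type*} [NormedAddCommGroup E] [InnerProductSpace ℝ E]
    (Q : ℕ) (C : Set α) (a : ℕ → α → E) (A κ : ℝ) (hA : ∀ q, ∀ z ∈ C, ‖a q z‖ ≤ A)
    (hκ : ∀ c : E, ∃ z : ℕ → α, (∀ q, z q ∈ C) ∧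
      -(κ * ‖c‖) ≤ ∑ q ∈ Finset.range Q, ⟪c, a q (z q)⟫) :
    ∃ z : ℕ → α, (∀ q, z q ∈ C) ∧ ‖∑ q ∈ Finset.range Q, a q (z q)‖ ^ 2 ≤
      κ * ‖∑ q ∈ Finset.range Q, a q (z q)‖ + Q * (2 * A ^ 2 + 1) := by
  classical
  set s : (ℕ → α) → E := fun z => ∑ q ∈ Finset.range Q, a q (z q) with hs
  set I : Set ℝ := (fun z => ‖s z‖ ^ 2) '' {z | ∀ q, z q ∈ C} with hI
  have hne : I.Nonempty := by
    obtain ⟨z, hz, -⟩ := hκ 0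
    exact ⟨_, z, hz, rfl⟩
  have hbdd : BddBelow I := ⟨0, by rintro _ ⟨z, _, rfl⟩; positivity⟩
  -- The infimum need not be attained; the slack `1` is the source of the `+ 1` in the bound.
  obtain ⟨_, ⟨z, hz, rfl⟩, hlt⟩ := exists_lt_of_csInf_lt hne (lt_add_one (sInf I))
  have hmin : ∀ z', (∀ q, z' q ∈ C) → ‖s z‖ ^ 2 ≤ ‖s z'‖ ^ 2 + 1 := by
    intro z' hz'
    have := csInf_le hbdd ⟨z', hz', rfl⟩
    simp only at hlt this
    linarith
  refine ⟨z, hz, ?_⟩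
  have key : ∀ q < Q, ∀ v ∈ C, ⟪-s z, a q v - a q (z q)⟫ ≤ 2 * A ^ 2 + 1 := by
    intro q hq v hv
    have h1 := hmin (Function.update z q v) (by
      intro q'
      by_cases h : q' = q
      · subst h; simpa using hv
      · simpa [h] using hz q')
    have h2 : s (Function.update z q v) = s z + (a q v - a q (z q)) := by
      simp only [hs]
      have hq' : q ∈ Finset.range Q := Finset.mem_range.2 hq
      rw [← Finset.add_sum_erase _ _ hq', ← Finset.add_sum_erase _ _ hq']
      have : ∑ x ∈ (Finset.range Q).erase q, a x (Function.update z q v x)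
          = ∑ x ∈ (Finset.range Q).erase q, a x (z x) :=
        Finset.sum_congr rfl fun x hx => by
          rw [Function.update_of_ne (Finset.ne_of_mem_erase hx)]
      rw [this, Function.update_self]; abel
    rw [h2, norm_add_sq_real] at h1
    have h3 : ‖a q v - a q (z q)‖ ≤ 2 * A := by
      have := norm_sub_le (a q v) (a q (z q))
      have := hA q v hv
      have := hA q (z q) (hz q)
      linarith
    have h4 : ‖a q v - a q (z q)‖ ^ 2 ≤ (2 * A) ^ 2 :=
      pow_le_pow_left₀ (norm_nonneg _) h3 2
    rw [inner_neg_left]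
    nlinarith
  obtain ⟨z', hz', hsum⟩ := hκ (-s z)
  have h1 : ∑ q ∈ Finset.range Q, ⟪-s z, a q (z' q) - a q (z q)⟫ ≤ Q * (2 * A ^ 2 + 1) := by
    have := Finset.sum_le_sum fun q (hq : q ∈ Finset.range Q) =>
      key q (Finset.mem_range.1 hq) (z' q) (hz' q)
    rwa [Finset.sum_const, Finset.card_range, nsmul_eq_mul] at this
  simp only [inner_sub_right, Finset.sum_sub_distrib] at h1
  have h2 : ∑ q ∈ Finset.range Q, ⟪-s z, a q (z q)⟫ = -‖s z‖ ^ 2 := by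
    rw [← inner_sum, inner_neg_left, real_inner_self_eq_norm_sq]
  rw [h2] at h1
  rw [norm_neg] at hsum
  change ‖s z‖ ^ 2 ≤ κ * ‖s z‖ + _
  linarith

/-! ### Sums over windows, and the mean ergodic theorem. -/

theorem sum_range_mul {E : Type*} [AddCommMonoid E] (h : ℕ → E) (J P : ℕ) :
    ∑ i ∈ Finset.range (J * P), h i
      = ∑ j ∈ Finset.range J, ∑ s ∈ Finset.range P, h (j * P + s) := by
  induction J with
  | zero => simp
  | succ J ih => rw [Nat.succ_mul, Finset.sum_range_add, ih, Finset.sum_range_succ]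

theorem norm_sum_range_le {E : Type*} [SeminormedAddCommGroup E] {h : ℕ → E} {B : ℝ}
    (n : ℕ) (hB : ∀ i, ‖h i‖ ≤ B) : ‖∑ i ∈ Finset.range n, h i‖ ≤ n * B := by
  simpa using norm_sum_le_of_le (Finset.range n) fun i _ => hB i

/-- A superblock has `J + 1` periods but only `J` windows: the spare period leaves room for any
offset `r`. What is lost is the `J` gaps and one period in total. -/
theorem norm_sum_window_sub_le {E : Type*} [SeminormedAddCommGroup E] {h : ℕ → E} {B : ℝ}
    (hB : ∀ i, ‖h i‖ ≤ B) (J g L : ℕ) {r : ℕ} (hr : r ≤ g + L) :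
    ‖∑ i ∈ Finset.range ((J + 1) * (g + L)), h i -
      ∑ j ∈ Finset.range J, ∑ t ∈ Finset.range L, h (r + j * (g + L) + g + t)‖
      ≤ (J * g + (g + L)) * B := by
  have e1 : (J + 1) * (g + L) = r + J * (g + L) + (g + L - r) := by
    rw [Nat.succ_mul]; omega
  have e2 : ∑ i ∈ Finset.range (J * (g + L)), h (r + i)
      = ∑ j ∈ Finset.range J, ∑ s ∈ Finset.range g, h (r + (j * (g + L) + s)) +
        ∑ j ∈ Finset.range J, ∑ t ∈ Finset.range L, h (r + j * (g + L) + g + t) := by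
    rw [sum_range_mul (fun i => h (r + i)), ← Finset.sum_add_distrib]
    refine Finset.sum_congr rfl fun j _ => ?_
    rw [Finset.sum_range_add]
    simp only [add_assoc]
  rw [e1, Finset.sum_range_add, Finset.sum_range_add, e2]
  have e3 : ∀ a b c d : E, a + (b + c) + d - c = a + b + d := by intros; abel
  rw [e3]
  have h1 := norm_sum_range_le r hB
  have h2 : ‖∑ j ∈ Finset.range J, ∑ s ∈ Finset.range g, h (r + (j * (g + L) + s))‖
      ≤ J * (g * B) :=
    norm_sum_range_le J fun j => norm_sum_range_le g fun s => hB _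
  have h3 := norm_sum_range_le (h := fun i => h (r + J * (g + L) + i)) (g + L - r) fun i => hB _
  have h4 := norm_add₃_le (a := ∑ i ∈ Finset.range r, h i)
    (b := ∑ j ∈ Finset.range J, ∑ s ∈ Finset.range g, h (r + (j * (g + L) + s)))
    (c := ∑ i ∈ Finset.range (g + L - r), h (r + J * (g + L) + i))
  rw [Nat.cast_sub hr] at h3
  push_cast at h3
  calc _ ≤ _ := h4
    _ ≤ r * B + J * (g * B) + (g + L - r) * B := by gcongr
    _ = _ := by ring

theorem eventually_measure_birkhoffSum_le {X E : Type*} [MeasurableSpace X]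
    [NormedAddCommGroup E] [InnerProductSpace ℝ E] [CompleteSpace E]
    {T : X → X} {μ : Measure X} [IsProbabilityMeasure μ] (hμ : Ergodic T μ) {H : X → E}
    (hH : MemLp H 2 μ) (hH₀ : ∫ x, H x ∂μ = 0) {θ : ℝ} (hθ : 0 < θ) :
    ∀ᶠ L : ℕ in atTop,
      μ {x | θ * L ≤ ‖∑ t ∈ Finset.range L, H (T^[t] x)‖} ≤ ENNReal.ofReal θ := by
  have hT := hμ.toMeasurePreserving
  set U : Lp E 2 μ →ₗᵢ[ℝ] Lp E 2 μ := Lp.compMeasurePreservingₗᵢ ℝ T hT with hU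
  set V := U.toContinuousLinearMap.eqLocus (1 : Lp E 2 μ →L[ℝ] Lp E 2 μ) with hV
  have hlim := U.toContinuousLinearMap.tendsto_birkhoffAverage_orthogonalProjection
    U.norm_toContinuousLinearMap_le (hH.toLp H)
  -- By ergodicity an invariant function is a constant `c`, and `H` is orthogonal to constants
  -- because its mean is zero.
  have hproj : (V.orthogonalProjectionOnto (hH.toLp H) : Lp E 2 μ) = 0 := by
    set v := V.orthogonalProjectionOnto (hH.toLp H) with hv
    have hvU : Lp.compMeasurePreserving T hT (v : Lp E 2 μ) = v := v.2
    have hinv : (v : Lp E 2 μ) ∘ T =ᵐ[μ] (v : Lp E 2 μ) := by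
      have := Lp.coeFn_compMeasurePreserving (v : Lp E 2 μ) hT
      rw [hvU] at this
      exact this.symm
    obtain ⟨c, hc⟩ := hμ.ae_eq_const_of_ae_eq_comp_ae (Lp.aestronglyMeasurable _) hinv
    have h1 : ⟪hH.toLp H - (v : Lp E 2 μ), (v : Lp E 2 μ)⟫ = 0 := by
      rw [real_inner_comm]
      exact V.sub_starProjection_mem_orthogonal (hH.toLp H) v v.2
    have h2 : ⟪hH.toLp H, (v : Lp E 2 μ)⟫ = 0 := by
      rw [L2.inner_def]
      have : (fun a => ⟪(hH.toLp H : X → E) a, ((v : Lp E 2 μ) : X → E) a⟫)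
          =ᵐ[μ] fun a => ⟪c, H a⟫ := by
        filter_upwards [hc, hH.coeFn_toLp] with a h1 h2
        rw [h1, h2, real_inner_comm]; rfl
      rw [integral_congr_ae this, integral_inner (hH.integrable (by norm_num)), hH₀, inner_zero_right]
    rw [inner_sub_left, h2, zero_sub, neg_eq_zero, inner_self_eq_zero] at h1
    exact h1
  replace hlim : Tendsto (fun n => birkhoffAverage ℝ (U.toContinuousLinearMap) _root_.id n
      (hH.toLp H)) atTop (𝓝 0) := hproj ▸ hlim
  have hmeas := tendstoInMeasure_of_tendsto_Lp hlim
  have h3 := hmeas (ENNReal.ofReal θ) (by simpa using hθ)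
  have h4 := h3.eventually (gt_mem_nhds (show 0 < ENNReal.ofReal θ by simpa using hθ))
  filter_upwards [h4, eventually_gt_atTop 0] with L hL hL0
  refine le_trans (measure_mono_ae ?_) hL.le
  have hrep : ∀ t : ℕ, ((U.toContinuousLinearMap)^[t] (hH.toLp H) : X → E) =ᵐ[μ]
      fun x => H (T^[t] x) := by
    intro t
    have : (U.toContinuousLinearMap)^[t] (hH.toLp H)
        = Lp.compMeasurePreserving T^[t] (hT.iterate t) (hH.toLp H) := by
      have := congrFun (Lp.compMeasurePreserving_iterate (E := E) (p := 2) hT t) (hH.toLp H)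
      rw [← this]; rfl
    rw [this]
    exact (Lp.coeFn_compMeasurePreserving _ _).trans
      ((hT.iterate t).quasiMeasurePreserving.ae_eq_comp hH.coeFn_toLp)
  have havg : ((birkhoffAverage ℝ (U.toContinuousLinearMap) _root_.id L (hH.toLp H) : Lp E 2 μ) : X → E)
      =ᵐ[μ] fun x => (L : ℝ)⁻¹ • ∑ t ∈ Finset.range L, H (T^[t] x) := by
    rw [birkhoffAverage, birkhoffSum]
    refine (Lp.coeFn_smul _ _).trans ?_
    have h5 := Lp.coeFn_finsetSum (Finset.range L)
      (fun t => (U.toContinuousLinearMap)^[t] (hH.toLp H))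
    have h6 : ∀ᵐ x ∂μ, ∀ t : ℕ, ((U.toContinuousLinearMap)^[t] (hH.toLp H) : X → E) x
      = H (T^[t] x) := ae_all_iff.2 hrep
    filter_upwards [h5, h6] with x h5 h6
    simp only [Pi.smul_apply]
    congr 1
    simp only [id] at *
    rw [h5, Finset.sum_apply]
    exact Finset.sum_congr rfl fun t _ => h6 t
  filter_upwards [havg, Lp.coeFn_zero E 2 μ] with x hx h0 hxm
  change ENNReal.ofReal θ ≤ edist _ _
  rw [hx, h0, edist_dist]
  apply ENNReal.ofReal_le_ofReal
  simp only [Pi.zero_apply, dist_zero_right, norm_smul, norm_inv, RCLike.norm_natCast]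
  have hxm' : θ * L ≤ ‖∑ t ∈ Finset.range L, H (T^[t] x)‖ := hxm
  have : (0 : ℝ) < L := by exact_mod_cast hL0
  rw [inv_mul_eq_div, le_div_iff₀ this]
  exact hxm'

/-! ### Directional lower bounds along the orbit of `y`. -/

theorem integral_empiricalMeasure {X : Type*} [MeasurableSpace X] (T : X → X) (x : X) (n : ℕ)
    {f : X → ℝ} (hf : StronglyMeasurable f) :
    ∫ a, f a ∂(empiricalMeasure T x n : Measure X)
      = ((n : ℝ) + 1)⁻¹ * ∑ i ∈ Finset.range (n + 1), f (T^[i] x) := by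
  change ∫ a, f a ∂(((n : ENNReal) + 1)⁻¹ • ∑ i ∈ Finset.range (n + 1), Measure.dirac (T^[i] x)) = _
  rw [integral_smul_measure, integral_finsetSum_measure]
  · simp only [integral_dirac' f _ hf, smul_eq_mul, ENNReal.toReal_inv]
    congr 2
  · intro i _
    exact integrable_dirac' hf (by simp)

theorem continuous_integrable {X E : Type*} [TopologicalSpace X] [CompactSpace X]
    [MeasurableSpace X] [OpensMeasurableSpace X] [NormedAddCommGroup E]
    {μ : Measure X} [IsFiniteMeasure μ] {f : X → E} (hf : Continuous f) : Integrable f μ :=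
  hf.integrable_of_hasCompactSupport (HasCompactSupport.of_compactSpace f)

/-- The time `n` precedes `c`: `exists_selection` needs all directions at the same `n`. Window sums
are taken at every starting time `i`; they are thinned out to disjoint windows later. -/
theorem exists_forall_le_sum_inner
    {X Y E : Type*}
    [MetricSpace X] [CompactSpace X] [MeasurableSpace X] [BorelSpace X]
    [MetricSpace Y] [CompactSpace Y] [MeasurableSpace Y] [BorelSpace Y]
    [NormedAddCommGroup E] [InnerProductSpace ℝ E] [FiniteDimensional ℝ E]
    {T : X → X} (hT : Continuous T) {S : Y → Y} (hS : Continuous S)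
    {ξ : ProbabilityMeasure (X × Y)} {μ : ProbabilityMeasure X} {ν : ProbabilityMeasure Y}
    (hξ : MeasurePreserving (Prod.map T S) (ξ : Measure (X × Y)) (ξ : Measure (X × Y)))
    (hξμ : (ξ : Measure (X × Y)).map Prod.fst = (μ : Measure X))
    (hξν : (ξ : Measure (X × Y)).map Prod.snd = (ν : Measure Y))
    {y : Y} (hy : IsQuasiGeneric S y ν)
    (F : C(X × Y, E)) (hF : ∫ p, F p ∂(ξ : Measure (X × Y)) = 0) {B : ℝ} (hB : ∀ p, ‖F p‖ ≤ B)
    {G : Set X} (hG : IsClosed G) (hGne : G.Nonempty) (L : ℕ) {δ : ℝ} (hδ : 0 < δ) (N : ℕ) :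
    ∃ n ≥ N, ∀ c : E, ∃ z : ℕ → X, (∀ i, z i ∈ G) ∧
      -((2 * L * B * (μ : Measure X).real Gᶜ + δ) * ‖c‖ * n) ≤
        ∑ i ∈ Finset.range n,
          ⟪c, ∑ t ∈ Finset.range L, F (T^[t] (z i), S^[i + t] y)⟫ := by
  classical
  obtain ⟨x₀, hx₀⟩ := hGne
  have hB0 : 0 ≤ B := (norm_nonneg _).trans (hB (x₀, y))
  set V : X → Y → E := fun x y' => ∑ t ∈ Finset.range L, F (T^[t] x, S^[t] y') with hV
  have hVc : Continuous fun p : X × Y => V p.1 p.2 := by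
    simp only [hV]
    refine continuous_finsetSum _ fun t _ => F.continuous.comp ?_
    exact ((hT.iterate t).comp continuous_fst).prodMk ((hS.iterate t).comp continuous_snd)
  have hVB : ∀ x y', ‖V x y'‖ ≤ L * B := fun x y' => norm_sum_range_le L fun t => hB _
  have hcV : ∀ c x y', |⟪c, V x y'⟫| ≤ L * B * ‖c‖ := by
    intro c x y'
    refine (abs_real_inner_le_norm _ _).trans ?_
    rw [mul_comm]
    gcongr
    exact hVB x y'
  -- The support function of `V(G, y')`; compactness of `G` makes it continuous in `y'`, so it can
  -- serve as a weak* test function.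
  set φ : E → Y → ℝ := fun c y' => sSup ((fun x => ⟪c, V x y'⟫) '' G) with hφ
  have hφc : ∀ c, Continuous (φ c) := by
    intro c
    refine hG.isCompact.continuous_sSup (f := fun (y' : Y) (x : X) => ⟪c, V x y'⟫) ?_
    exact continuous_const.inner (hVc.comp continuous_swap)
  have hφbdd : ∀ c y', BddAbove ((fun x => ⟪c, V x y'⟫) '' G) := by
    intro c y'
    refine ⟨L * B * ‖c‖, ?_⟩
    rintro _ ⟨x, _, rfl⟩
    exact (abs_le.1 (hcV c x y')).2
  have hφle : ∀ c y', ∀ x ∈ G, ⟪c, V x y'⟫ ≤ φ c y' := fun c y' x hx =>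
    le_csSup (hφbdd c y') ⟨x, hx, rfl⟩
  have hφatt : ∀ c y', ∃ x ∈ G, φ c y' = ⟪c, V x y'⟫ := by
    intro c y'
    refine hG.isCompact.exists_sSup_image_eq ⟨x₀, hx₀⟩ (Continuous.continuousOn ?_)
    exact continuous_const.inner (hVc.comp (continuous_id.prodMk continuous_const))
  have hφint : ∀ c, -(2 * L * B * ‖c‖ * (μ : Measure X).real Gᶜ) ≤ ∫ y', φ c y' ∂(ν : Measure Y) := by
    intro c
    have hV0 : ∫ p, V p.1 p.2 ∂(ξ : Measure (X × Y)) = 0 := by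
      simp only [hV]
      rw [integral_finsetSum]
      · refine Finset.sum_eq_zero fun t _ => ?_
        have h1 := integral_map (μ := (ξ : Measure (X × Y))) (hξ.iterate t).measurable.aemeasurable
          (f := F) F.continuous.aestronglyMeasurable
        rw [(hξ.iterate t).map_eq, hF] at h1
        simpa [Prod.map_iterate, Prod.map] using h1.symm
      · intro t _
        exact continuous_integrable (F.continuous.comp
          (((hT.iterate t).comp continuous_fst).prodMk ((hS.iterate t).comp continuous_snd)))
    have h1 : ∫ y', φ c y' ∂(ν : Measure Y) = ∫ p : X × Y, φ c p.2 ∂(ξ : Measure (X × Y)) := by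
      rw [← hξν, integral_map measurable_snd.aemeasurable (hφc c).aestronglyMeasurable]
    -- For `x ∉ G` the pairing may exceed `φ c`, but by at most `2 * L * B * ‖c‖`; the indicator
    -- subtracts exactly this.
    have h2 : ∫ p : X × Y, (⟪c, V p.1 p.2⟫ -
        (Prod.fst ⁻¹' Gᶜ).indicator (fun _ => 2 * L * B * ‖c‖) p) ∂(ξ : Measure (X × Y))
        = -(2 * L * B * ‖c‖ * (μ : Measure X).real Gᶜ) := by
      have hm : MeasurableSet (Prod.fst ⁻¹' Gᶜ : Set (X × Y)) :=
        measurable_fst hG.measurableSet.compl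
      rw [integral_sub (continuous_integrable (continuous_const.inner hVc))
        ((integrable_const _).indicator hm),
        integral_inner (continuous_integrable hVc), hV0, inner_zero_right,
        integral_indicator_const _ hm, ← hξμ,
        map_measureReal_apply measurable_fst hG.measurableSet.compl, smul_eq_mul]
      ring
    rw [h1, ← h2]
    refine integral_mono ((continuous_integrable (continuous_const.inner hVc)).sub
        ((integrable_const _).indicator (measurable_fst hG.measurableSet.compl)))
        (continuous_integrable ((hφc c).comp continuous_snd)) ?_
    rintro ⟨x, y'⟩
    by_cases hx : x ∈ G
    · have : (x, y') ∉ (Prod.fst ⁻¹' Gᶜ : Set (X × Y)) := by simpa using hx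
      simp only [Set.indicator_of_notMem this, sub_zero]
      exact hφle c y' x hx
    · have : (x, y') ∈ (Prod.fst ⁻¹' Gᶜ : Set (X × Y)) := by simpa using hx
      simp only [Set.indicator_of_mem this]
      obtain ⟨x', -, h'⟩ := hφatt c y'
      rw [h']
      have h1 := abs_le.1 (hcV c x y')
      have h2 := abs_le.1 (hcV c x' y')
      linarith [h1.2, h2.1]
  set e : ℝ := δ / (2 * (L * B + 1)) with he
  have hLB : 0 ≤ L * B := by positivity
  have he0 : 0 < e := by positivity
  have heδ : L * B * e ≤ δ / 2 := by
    rw [he, mul_div_assoc', div_le_div_iff₀ (by positivity) (by norm_num)]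
    nlinarith
  -- Weak* closeness controls only finitely many functions at a common `n`, hence a finite `e`-net
  -- of unit directions; passing to a net point costs at most `δ / 2`.
  obtain ⟨s, hs, hsf, hcov⟩ := (isCompact_sphere (0 : E) 1).finite_cover_balls he0
  have hfreq : ∃ᶠ n : ℕ in atTop, ∀ c ∈ s, ∫ y', φ c y' ∂(ν : Measure Y) - δ / 2 <
      ∫ y', φ c y' ∂(empiricalMeasure S y n : Measure Y) := by
    refine MapClusterPt.frequently hy (p := fun m : ProbabilityMeasure Y =>
      ∀ c ∈ s, ∫ y', φ c y' ∂(ν : Measure Y) - δ / 2 < ∫ y', φ c y' ∂(m : Measure Y)) ?_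
    rw [eventually_all_finite hsf]
    intro c _
    have h1 := (ProbabilityMeasure.continuous_integral_boundedContinuousFunction
      (BoundedContinuousFunction.mkOfCompact ⟨φ c, hφc c⟩)).tendsto ν
    exact h1.eventually (lt_mem_nhds (by simpa using hδ))
  obtain ⟨n, hn, hnN⟩ := (hfreq.and_eventually (eventually_ge_atTop N)).exists
  refine ⟨n + 1, by omega, ?_⟩
  have hsphere : ∀ c : E, ‖c‖ = 1 → ∃ z : ℕ → X, (∀ i, z i ∈ G) ∧
      -((2 * L * B * (μ : Measure X).real Gᶜ + δ) * ((n + 1 : ℕ) : ℝ)) ≤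
        ∑ i ∈ Finset.range (n + 1), ⟪c, V (z i) (S^[i] y)⟫ := by
    intro c hc
    obtain ⟨c₀, hc₀, hcc₀⟩ := Set.mem_iUnion₂.1 (hcov (mem_sphere_zero_iff_norm.2 hc))
    have hc₀1 : ‖c₀‖ = 1 := mem_sphere_zero_iff_norm.1 (hs hc₀)
    choose z hzG hz using fun i : ℕ => hφatt c₀ (S^[i] y)
    refine ⟨z, hzG, ?_⟩
    have h1 := hn c₀ hc₀
    rw [integral_empiricalMeasure _ _ _ (hφc c₀).stronglyMeasurable,
      inv_mul_eq_div] at h1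
    have h2 := hφint c₀
    rw [hc₀1, mul_one] at h2
    have hn1 : (0 : ℝ) < n + 1 := by positivity
    have h3 : (-(2 * L * B * (μ : Measure X).real Gᶜ) - δ / 2) * (n + 1) ≤
        ∑ i ∈ Finset.range (n + 1), φ c₀ (S^[i] y) := by
      rw [← le_div_iff₀ hn1]
      linarith
    have h4 : ∑ i ∈ Finset.range (n + 1), (φ c₀ (S^[i] y) - δ / 2) ≤
        ∑ i ∈ Finset.range (n + 1), ⟪c, V (z i) (S^[i] y)⟫ := by
      refine Finset.sum_le_sum fun i _ => ?_
      rw [hz]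
      have h5 := (abs_le.1 (hcV (c - c₀) (z i) (S^[i] y))).1
      rw [inner_sub_left] at h5
      have h6 : ‖c - c₀‖ ≤ e := by rw [← dist_eq_norm]; exact (Metric.mem_ball.1 hcc₀).le
      have h7 := mul_le_mul_of_nonneg_left h6 hLB
      linarith
    rw [Finset.sum_sub_distrib, Finset.sum_const, Finset.card_range, nsmul_eq_mul] at h4
    push_cast at h4 ⊢
    linarith
  have hVeq : ∀ x i, V x (S^[i] y) = ∑ t ∈ Finset.range L, F (T^[t] x, S^[i + t] y) := by
    intro x i
    simp only [hV]
    refine Finset.sum_congr rfl fun t _ => ?_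
    rw [add_comm i t, Function.iterate_add_apply]
  intro c
  by_cases hc : c = 0
  · exact ⟨fun _ => x₀, fun _ => hx₀, by simp [hc]⟩
  have hcn : 0 < ‖c‖ := norm_pos_iff.2 hc
  obtain ⟨z, hzG, hz⟩ := hsphere (‖c‖⁻¹ • c) (by
    rw [norm_smul, norm_inv, norm_norm, inv_mul_cancel₀ hcn.ne'])
  refine ⟨z, hzG, ?_⟩
  simp only [inner_smul_left, ← Finset.mul_sum, hVeq] at hz
  have h1 := mul_le_mul_of_nonneg_left hz hcn.le
  rw [← mul_assoc] at h1
  simp only [conj_trivial, mul_inv_cancel₀ hcn.ne', one_mul] at h1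
  refine le_trans (le_of_eq ?_) h1
  ring

/-! ### Superblocks and their offsets. -/

theorem norm_sum_windows_sub_le {E : Type*} [SeminormedAddCommGroup E] {h : ℕ → E} {B : ℝ}
    (hB : ∀ i, ‖h i‖ ≤ B) (Q J g L n₀ : ℕ) {r : ℕ → ℕ} (hr : ∀ q, r q < g + L) :
    ‖∑ i ∈ Finset.range (Q * ((J + 1) * (g + L))), h (n₀ + i) -
      ∑ q ∈ Finset.range Q, ∑ j ∈ Finset.range J, ∑ t ∈ Finset.range L,
        h (n₀ + q * ((J + 1) * (g + L)) + (r q + j * (g + L) + g) + t)‖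
      ≤ Q * ((J * g + (g + L)) * B) := by
  rw [sum_range_mul (fun i => h (n₀ + i)), ← Finset.sum_sub_distrib]
  refine norm_sum_range_le Q fun q => ?_
  have := norm_sum_window_sub_le (h := fun i => h (n₀ + (q * ((J + 1) * (g + L)) + i)))
    (fun i => hB _) J g L (hr q).le
  simpa only [add_assoc] using this

/-- Pigeonhole over residues mod `P`: some progression of disjoint windows does at least as well as
the average over all starting times. -/
theorem exists_offset (h : ℕ → ℝ) (J : ℕ) {P : ℕ} (hP : 0 < P) (w : ℕ) :
    ∃ r < P, ∑ i ∈ Finset.range (J * P), h (w + i) ≤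
      P * ∑ j ∈ Finset.range J, h (w + (r + j * P)) := by
  have h1 : ∑ i ∈ Finset.range (J * P), h (w + i)
      = ∑ r ∈ Finset.range P, ∑ j ∈ Finset.range J, h (w + (r + j * P)) := by
    rw [sum_range_mul (fun i => h (w + i)), Finset.sum_comm]
    simp only [add_comm]
  have h2 : ∑ r ∈ Finset.range P, (∑ i ∈ Finset.range (J * P), h (w + i)) / P ≤
      ∑ r ∈ Finset.range P, ∑ j ∈ Finset.range J, h (w + (r + j * P)) := by
    rw [Finset.sum_const, Finset.card_range, nsmul_eq_mul, ← h1,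
      mul_div_cancel₀ _ (by positivity)]
  obtain ⟨r, hr, hle⟩ := Finset.exists_le_of_sum_le ⟨0, Finset.mem_range.2 hP⟩ h2
  refine ⟨r, Finset.mem_range.1 hr, ?_⟩
  rwa [div_le_iff₀' (by positivity)] at hle

theorem sum_range_le_sum_windows {h : ℕ → ℝ} {b : ℝ} (hb : ∀ i, ‖h i‖ ≤ b) (J g L n₀ n Q : ℕ)
    (hn : n₀ + Q * ((J + 1) * (g + L)) ≤ n)
    (hn' : n ≤ n₀ + Q * ((J + 1) * (g + L)) + (J + 1) * (g + L)) :
    ∑ i ∈ Finset.range n, h i ≤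
      ∑ q ∈ Finset.range Q, ∑ i ∈ Finset.range (J * (g + L)),
        h (n₀ + q * ((J + 1) * (g + L)) + g + i) +
      (n₀ + (J + 1) * (g + L) + Q * (g + L)) * b := by
  have hb0 : 0 ≤ b := (norm_nonneg _).trans (hb 0)
  obtain ⟨m, rfl⟩ := Nat.exists_eq_add_of_le hn
  have hm : m ≤ (J + 1) * (g + L) := by omega
  have hle : ∀ (k : ℕ) (f : ℕ → ℕ), ∑ i ∈ Finset.range k, h (f i) ≤ k * b := fun k f =>
    (le_abs_self _).trans (norm_sum_range_le k fun i => hb (f i))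
  have e : (J + 1) * (g + L) = g + J * (g + L) + L := by ring
  have h1 : ∑ i ∈ Finset.range (Q * ((J + 1) * (g + L))), h (n₀ + i) ≤
      ∑ q ∈ Finset.range Q, (∑ i ∈ Finset.range (J * (g + L)),
        h (n₀ + q * ((J + 1) * (g + L)) + g + i) + (g + L) * b) := by
    rw [sum_range_mul (fun i => h (n₀ + i))]
    refine Finset.sum_le_sum fun q _ => ?_
    conv_lhs => rw [e]
    rw [Finset.sum_range_add, Finset.sum_range_add]
    have h2 := hle g fun i => n₀ + (q * (g + J * (g + L) + L) + i)
    have h3 := hle L fun i => n₀ + (q * (g + J * (g + L) + L) + (g + J * (g + L) + i))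
    simp only [e, add_assoc] at *
    linarith
  rw [Finset.sum_add_distrib, Finset.sum_const, Finset.card_range, nsmul_eq_mul] at h1
  rw [Finset.sum_range_add, Finset.sum_range_add]
  have h2 := hle n₀ fun i => i
  have h3 := hle m fun i => n₀ + Q * ((J + 1) * (g + L)) + i
  have h4 : (m : ℝ) * b ≤ ((J + 1) * (g + L)) * b := by
    refine mul_le_mul_of_nonneg_right ?_ hb0
    exact_mod_cast hm
  linarith

/-- A good offset depends on the direction `c`, so one global offset could not be fixed beforehand.
Giving each superblock its own offset makes it part of the coordinate that `exists_selection`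
chooses. -/
theorem exists_blocks
    {X Y E : Type*} [TopologicalSpace X] [TopologicalSpace Y]
    [NormedAddCommGroup E] [InnerProductSpace ℝ E]
    {T : X → X} {S : Y → Y} {y : Y} (F : C(X × Y, E)) {B : ℝ} (hB : ∀ p, ‖F p‖ ≤ B)
    {G : Set X} {L g J n₀ n Q : ℕ} (hL : 0 < L)
    (hn : n₀ + Q * ((J + 1) * (g + L)) ≤ n)
    (hn' : n ≤ n₀ + Q * ((J + 1) * (g + L)) + (J + 1) * (g + L)) {κ : ℝ}
    (hκ : ∀ c : E, ∃ z : ℕ → X, (∀ i, z i ∈ G) ∧ -(κ * ‖c‖ * n) ≤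
        ∑ i ∈ Finset.range n,
          ⟪c, ∑ t ∈ Finset.range L, F (T^[t] (z i), S^[i + t] y)⟫) :
    ∃ (r : ℕ → ℕ) (x : ℕ → ℕ → X) (s : E), (∀ q, r q < g + L) ∧ (∀ q j, x q j ∈ G) ∧
      s = ∑ q ∈ Finset.range Q, ∑ j ∈ Finset.range J, ∑ t ∈ Finset.range L,
        F (T^[t] (x q j), S^[n₀ + q * ((J + 1) * (g + L)) + (r q + j * (g + L) + g) + t] y) ∧
      ‖s‖ ^ 2 ≤ (κ * n + (n₀ + (J + 1) * (g + L) + Q * (g + L)) * (L * B)) / (g + L) * ‖s‖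
        + Q * (2 * (J * (L * B)) ^ 2 + 1) := by
  set a : ℕ → ℕ × (ℕ → X) → E := fun q v =>
    ∑ j ∈ Finset.range J, ∑ t ∈ Finset.range L,
        F (T^[t] (v.2 j), S^[n₀ + q * ((J + 1) * (g + L)) + (v.1 + j * (g + L) + g) + t] y) with ha
  have hP : (0 : ℝ) < g + L := by positivity
  obtain ⟨z, hz, hs⟩ := exists_selection Q {v : ℕ × (ℕ → X) | v.1 < g + L ∧ ∀ j, v.2 j ∈ G} a
    (J * (L * B)) ((κ * n + (n₀ + (J + 1) * (g + L) + Q * (g + L)) * (L * B)) / (g + L)) (by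
      intro q v _
      exact norm_sum_range_le J fun j => norm_sum_range_le L fun t => hB _) (by
      intro c
      obtain ⟨z, hzG, hz⟩ := hκ c
      set h : ℕ → ℝ := fun i => ⟪c, ∑ t ∈ Finset.range L, F (T^[t] (z i), S^[i + t] y)⟫ with hh
      have hb : ∀ i, ‖h i‖ ≤ ‖c‖ * (L * B) := fun i => (norm_inner_le_norm _ _).trans
        (mul_le_mul_of_nonneg_left (norm_sum_range_le L fun t => hB _) (norm_nonneg _))
      have h1 := sum_range_le_sum_windows hb J g L n₀ n Q hn hn'
      choose r hr hle using fun q => exists_offset h J (P := g + L) (by omega)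
        (n₀ + q * ((J + 1) * (g + L)) + g)
      have h2 := Finset.sum_le_sum fun q (_ : q ∈ Finset.range Q) => hle q
      rw [← Finset.mul_sum] at h2
      refine ⟨fun q => (r q, fun j => z (n₀ + q * ((J + 1) * (g + L)) + (r q + j * (g + L) + g))),
        fun q => ⟨hr q, fun j => hzG _⟩, ?_⟩
      have h3 : ∑ q ∈ Finset.range Q, ⟪c, a q (r q,
          fun j => z (n₀ + q * ((J + 1) * (g + L)) + (r q + j * (g + L) + g)))⟫
          = ∑ q ∈ Finset.range Q, ∑ j ∈ Finset.range J,
            h (n₀ + q * ((J + 1) * (g + L)) + g + (r q + j * (g + L))) := by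
        refine Finset.sum_congr rfl fun q _ => ?_
        simp only [ha]
        rw [inner_sum]
        refine Finset.sum_congr rfl fun j _ => ?_
        have : n₀ + q * ((J + 1) * (g + L)) + (r q + j * (g + L) + g)
          = n₀ + q * ((J + 1) * (g + L)) + g + (r q + j * (g + L)) := by ring
        rw [this]
      rw [h3, div_mul_eq_mul_div, ← neg_div, div_le_iff₀' hP]
      push_cast at h2
      linarith)
  exact ⟨fun q => (z q).1, fun q => (z q).2, _, fun q => (hz q).1, fun q => (hz q).2, rfl, hs⟩

/-- Window `i` is number `i % J` of superblock `i / J`. Between superblocks the spare period absorbs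
a drop of the offset. -/
theorem block_position_add_le {J g L n₀ : ℕ} (hJ : 0 < J) {r : ℕ → ℕ} (hr : ∀ q, r q < g + L)
    (i : ℕ) :
    n₀ + (i / J) * ((J + 1) * (g + L)) + (r (i / J) + (i % J) * (g + L) + g) + L + g ≤
      n₀ + ((i + 1) / J) * ((J + 1) * (g + L)) +
        (r ((i + 1) / J) + ((i + 1) % J) * (g + L) + g) := by
  have hi := Nat.div_add_mod i J
  have hlt := Nat.mod_lt i hJ
  set q := i / J
  set j := i % J
  by_cases h : j + 1 < J
  · have h1 : (i + 1) / J = q := by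
      rw [← hi, add_assoc, Nat.mul_add_div hJ, Nat.div_eq_of_lt h, add_zero]
    have h2 : (i + 1) % J = j + 1 := by
      rw [← hi, add_assoc, Nat.mul_add_mod, Nat.mod_eq_of_lt h]
    rw [h1, h2]
    have : (j + 1) * (g + L) = j * (g + L) + g + L := by ring
    omega
  · have hj : j + 1 = J := by omega
    have h0 : i + 1 = J * (q + 1) := by rw [← hi, add_assoc, hj]; ring
    have h1 : (i + 1) / J = q + 1 := by rw [h0, Nat.mul_div_cancel_left _ hJ]
    have h2 : (i + 1) % J = 0 := by rw [h0, Nat.mul_mod_right]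
    rw [h1, h2]
    have h3 : (q + 1) * ((J + 1) * (g + L)) = q * ((J + 1) * (g + L)) + (j * (g + L)) +
        2 * (g + L) := by rw [← hj]; ring
    have := hr q
    omega

/-! ### One stage: prolonging an orbit segment. -/

/-- The elementary estimate behind the choice of parameters in `exists_orbit_extension`. -/
theorem le_of_sq_le_mul_add {s κ R a : ℝ} (ha : 0 < a) (h : s ^ 2 ≤ κ * s + R)
    (hκ : κ ≤ a / 2) (hR : R ≤ a ^ 2 / 2) (hs : 0 ≤ s) : s ≤ a := by
  by_contra! hlt
  have : κ * s ≤ a / 2 * s := mul_le_mul_of_nonneg_right hκ hs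
  nlinarith

-- `K₀` depends neither on the prefix nor on `N`, so later lengths can be chosen to dwarf it. The
-- estimates hold for every `x'` that stays `ε`-close to `x`, so they survive the later
-- perturbations; shadowing plus perturbation gives `2 * ε`.
set_option maxHeartbeats 2000000 in
theorem exists_orbit_extension
    {X Y E E' : Type*}
    [MetricSpace X] [CompactSpace X] [MeasurableSpace X] [BorelSpace X]
    [MetricSpace Y] [CompactSpace Y] [MeasurableSpace Y] [BorelSpace Y]
    [NormedAddCommGroup E] [InnerProductSpace ℝ E] [FiniteDimensional ℝ E]
    [NormedAddCommGroup E'] [InnerProductSpace ℝ E'] [FiniteDimensional ℝ E']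
    {T : X → X} (hT : Continuous T) (hTsurj : Function.Surjective T)
    {S : Y → Y} (hS : Continuous S)
    {ξ : ProbabilityMeasure (X × Y)} {μ : ProbabilityMeasure X} {ν : ProbabilityMeasure Y}
    (hξ : MeasurePreserving (Prod.map T S) (ξ : Measure (X × Y)) (ξ : Measure (X × Y)))
    (hξμ : (ξ : Measure (X × Y)).map Prod.fst = (μ : Measure X))
    (hξν : (ξ : Measure (X × Y)).map Prod.snd = (ν : Measure Y))
    (hspec : WeakSpecification T) (hμ : Ergodic T (μ : Measure X))
    {y : Y} (hy : IsQuasiGeneric S y ν)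
    (F : C(X × Y, E)) (hF : ∫ p, F p ∂(ξ : Measure (X × Y)) = 0)
    (H : C(X, E')) (hH : ∫ x, H x ∂(μ : Measure X) = 0)
    {ε η : ℝ} (hε : 0 < ε) (hη : 0 < η) (hη1 : η ≤ 1)
    (hFε : ∀ p q, dist p q < 2 * ε → ‖F p - F q‖ ≤ η / 8)
    (hHε : ∀ p q, dist p q < 2 * ε → ‖H p - H q‖ ≤ η / 8) :
    ∃ K₀ : ℕ, ∀ (N : ℕ) (x₀ : X) (n₀ : ℕ), 0 < n₀ → ∃ (x : X) (n : ℕ), N ≤ n ∧ n₀ ≤ n ∧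
      (∀ i < n₀, dist (T^[i] x₀) (T^[i] x) < ε) ∧
      ∀ x', (∀ i < n, dist (T^[i] x) (T^[i] x') ≤ ε) →
        ‖∑ i ∈ Finset.range n, F (T^[i] x', S^[i] y)‖ ≤ η * n ∧
        ∀ m, n₀ + m ≤ n →
          ‖∑ i ∈ Finset.range m, H (T^[n₀ + i] x')‖ ≤ η * m + K₀ := by
  obtain ⟨B, hB1, hFB, hHB⟩ : ∃ B : ℝ, 1 ≤ B ∧ (∀ p, ‖F p‖ ≤ B) ∧ ∀ p, ‖H p‖ ≤ B :=
    ⟨max 1 (max ‖F‖ ‖H‖), le_max_left _ _,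
      fun p => (F.norm_coe_le_norm p).trans ((le_max_left _ _).trans (le_max_right _ _)),
      fun p => (H.norm_coe_le_norm p).trans ((le_max_right _ _).trans (le_max_right _ _))⟩
  have hB0 : 0 < B := by linarith
  obtain ⟨θ, hθ0, hθ1, hθB, hθB2⟩ : ∃ θ : ℝ, 0 < θ ∧ θ < 1 ∧ 5 * B * θ ≤ η / 8 ∧
      3 * B ^ 2 * θ ≤ (η / 4) ^ 2 / 2 := by
    refine ⟨η ^ 2 / (200 * B ^ 2), by positivity, ?_, ?_, ?_⟩
    · rw [div_lt_one (by positivity)]; nlinarith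
    · rw [mul_div_assoc', div_le_div_iff₀ (by positivity) (by norm_num)]
      have h1 : η ^ 2 ≤ η := by nlinarith
      have h2 : B ≤ B ^ 2 := by nlinarith
      have h3 : B * η ^ 2 ≤ B ^ 2 * η := mul_le_mul h2 h1 (by positivity) (by positivity)
      nlinarith [mul_pos hB0 hη]
    · rw [mul_div_assoc', div_le_div_iff₀ (by positivity) (by norm_num)]
      nlinarith [mul_pos (pow_pos hB0 2) (pow_pos hη 2)]
  obtain ⟨M, hMlim, hM⟩ := hspec ε hε
  -- With `J ≥ 1 / θ`, the spare period is at most a fraction `θ` of a superblock.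
  obtain ⟨J, hJ⟩ := exists_nat_gt (1 / θ)
  have hJθ : 1 ≤ θ * J := by
    rw [div_lt_iff₀ hθ0] at hJ; linarith
  have hJ0 : 0 < J := by
    rcases Nat.eq_zero_or_pos J with rfl | h
    · norm_num at hJθ
    · exact h
  have hHmem : MemLp H 2 (μ : Measure X) :=
    MemLp.of_bound H.continuous.aestronglyMeasurable B (ae_of_all _ hHB)
  obtain ⟨L, hLM, hLμ, hL0⟩ := ((hMlim.eventually (gt_mem_nhds hθ0)).and
    ((eventually_measure_birkhoffSum_le hμ hHmem hH hθ0).and (eventually_gt_atTop 0))).exists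
  have hL0' : (0 : ℝ) < L := by exact_mod_cast hL0
  have hLM' : (M L : ℝ) ≤ θ * L := by
    rw [div_lt_iff₀ hL0'] at hLM; exact hLM.le
  set g := M L with hg
  set G : Set X := {x | ‖∑ t ∈ Finset.range L, H (T^[t] x)‖ ≤ θ * L} with hG
  have hGc : IsClosed G := isClosed_le
    (continuous_finsetSum _ fun t _ => H.continuous.comp (hT.iterate t)).norm continuous_const
  have hGμ : (μ : Measure X).real Gᶜ ≤ θ := by
    refine ENNReal.toReal_le_of_le_ofReal hθ0.le ((measure_mono ?_).trans hLμ)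
    intro x hx
    simp only [hG, Set.mem_compl_iff, Set.mem_ofPred_eq, not_le] at hx
    exact hx.le
  have hGne : G.Nonempty := by
    by_contra hne
    rw [Set.not_nonempty_iff_eq_empty] at hne
    rw [hne, Set.compl_empty] at hGμ
    simp at hGμ
    linarith
  set P := g + L with hP
  set K := (J + 1) * P with hK
  have hP0 : 0 < P := by omega
  have hK0 : 0 < K := by positivity
  have hKr : (K : ℝ) = (J + 1) * (g + L) := by simp [hK, hP]
  -- This pays for the one incomplete superblock at the end of a sum of `H`.
  obtain ⟨K₀, hK₀⟩ := exists_nat_ge (K * B)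
  refine ⟨K₀, fun N x₀ n₀ hn₀ => ?_⟩
  obtain ⟨N₁, hN₁⟩ := exists_nat_ge ((n₀ + K) / θ)
  obtain ⟨n, hnN, hκ⟩ := exists_forall_le_sum_inner hT hS hξ hξμ hξν hy F hF hFB hGc hGne L
    (mul_pos hθ0 hL0') (max N (max n₀ N₁))
  have hnN0 : N ≤ n := (le_max_left _ _).trans hnN
  have hnn₀ : n₀ ≤ n := (le_max_left _ _).trans ((le_max_right _ _).trans hnN)
  have hnN₁ : N₁ ≤ n := (le_max_right _ _).trans ((le_max_right _ _).trans hnN)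
  have hnθ : (n₀ + K : ℝ) ≤ θ * n := by
    rw [div_le_iff₀ hθ0] at hN₁
    have : (N₁ : ℝ) ≤ n := by exact_mod_cast hnN₁
    nlinarith
  have hn0' : (0 : ℝ) < n := by
    have : 0 < n := by omega
    exact_mod_cast this
  set Q := (n - n₀) / K with hQ
  have hdm := Nat.div_add_mod (n - n₀) K
  have hml := Nat.mod_lt (n - n₀) hK0
  rw [← hQ, mul_comm] at hdm
  have hnQ : n₀ + Q * K ≤ n := by omega
  have hnQ' : n ≤ n₀ + Q * K + K := by omega
  obtain ⟨r, z, s, hr, hzG, hs, hsle⟩ := exists_blocks (T := T) (S := S) (y := y) F hFB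
    (G := G) (g := g) (J := J) hL0 hnQ hnQ' hκ
  have hQK : (Q * K : ℝ) ≤ n := by
    have : Q * K ≤ n := by omega
    exact_mod_cast this
  have hPK : (g + L : ℝ) ≤ θ * K := by
    rw [hKr]
    have h0 : (0 : ℝ) ≤ g + L := by positivity
    have h1 : 1 ≤ θ * (J + 1) := by linarith
    have := mul_le_mul_of_nonneg_right h1 h0
    linarith
  have hQP : Q * (g + L : ℝ) ≤ θ * n := by
    have h1 := mul_le_mul_of_nonneg_left hPK (Nat.cast_nonneg (α := ℝ) Q)
    have h2 := mul_le_mul_of_nonneg_left hQK hθ0.le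
    linarith
  have hJL : (J * L : ℝ) ≤ K := by
    rw [hKr]
    have h1 : (J : ℝ) ≤ J + 1 := by linarith
    have h2 : (L : ℝ) ≤ g + L := by
      have : (0 : ℝ) ≤ g := by positivity
      linarith
    exact mul_le_mul h1 h2 (by positivity) (by positivity)
  have hJg : (J * g : ℝ) ≤ θ * K := by
    have : (J * g : ℝ) ≤ J * (θ * L) := by gcongr
    have := mul_le_mul_of_nonneg_left hJL hθ0.le
    linarith
  have hsη : ‖s‖ ≤ η / 4 * n := by
    -- Here `a = η / 4 * n`. The linear term collects `3 * B * θ` from the directional bound and `2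
    -- * B * θ` from discarded starting times, whence the `5 * B * θ` in `hθB`; the remainder uses
    -- `hθB2`.
    refine le_of_sq_le_mul_add (by positivity) hsle ?_ ?_ (norm_nonneg _)
    · have h1 : (2 * L * B * (μ : Measure X).real Gᶜ + θ * L) * n ≤ 3 * B * θ * n * L := by
        have : 2 * L * B * (μ : Measure X).real Gᶜ ≤ 2 * L * B * θ := by gcongr
        have : θ * L ≤ B * (θ * L) := le_mul_of_one_le_left (by positivity) hB1
        have : 2 * L * B * (μ : Measure X).real Gᶜ + θ * L ≤ 3 * B * θ * L := by linarith
        have := mul_le_mul_of_nonneg_right this hn0'.le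
        linarith
      have h2 : (n₀ + (J + 1) * (g + L) + Q * (g + L)) * (L * B) ≤ (2 * θ * n) * (L * B) := by
        rw [← hKr]
        refine mul_le_mul_of_nonneg_right ?_ (by positivity)
        linarith
      have h3 : 5 * B * θ * n * L ≤ (η / 4 * n / 2) * (g + L) := by
        have h4 : 5 * B * θ * n ≤ η / 4 * n / 2 := by
          have := mul_le_mul_of_nonneg_right hθB hn0'.le
          linarith
        have h5 : (L : ℝ) ≤ g + L := by
          have : (0 : ℝ) ≤ g := by positivity
          linarith
        exact mul_le_mul h4 h5 (by positivity) (by positivity)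
      rw [div_le_iff₀ (by positivity)]
      linarith
    · have hK1 : (1 : ℝ) ≤ K := by exact_mod_cast hK0
      have hKB : 1 ≤ K * B := by nlinarith
      have h1 : (J * (L * B) : ℝ) ≤ K * B := by rw [← mul_assoc]; gcongr
      have h2 : (J * (L * B) : ℝ) ^ 2 ≤ (K * B) ^ 2 := by gcongr
      have h3 : (2 * (J * (L * B)) ^ 2 + 1 : ℝ) ≤ 3 * (K * B) ^ 2 := by nlinarith
      have h4 : (K : ℝ) ≤ θ * n := by
        have : (0 : ℝ) ≤ n₀ := by positivity
        linarith
      calc (Q * (2 * (J * (L * B)) ^ 2 + 1) : ℝ) ≤ Q * (3 * (K * B) ^ 2) := by gcongr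
        _ = 3 * B ^ 2 * ((Q * K) * K) := by ring
        _ ≤ 3 * B ^ 2 * (n * (θ * n)) := by gcongr
        _ = 3 * B ^ 2 * θ * n ^ 2 := by ring
        _ ≤ (η / 4) ^ 2 / 2 * n ^ 2 := by gcongr
        _ = _ := by ring
  obtain ⟨x, hx₀, hx⟩ := exists_shadowing_blocks hTsurj hM hL0 hn₀
    (fun i => n₀ + (i / J) * K + (r (i / J) + (i % J) * P + g))
    (by simp only [← hg]; omega) (fun i => block_position_add_le hJ0 hr i)
    (fun i => z (i / J) (i % J)) x₀ (Q * J)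
  refine ⟨x, n, hnN0, hnn₀, hx₀, fun x' hx' => ?_⟩
  have hshadow : ∀ q < Q, ∀ j < J, ∀ t < L,
      dist (T^[t] (z q j)) (T^[n₀ + q * K + (r q + j * P + g) + t] x') < 2 * ε := by
    intro q hq j hj t ht
    have h1 : (q * J + j) / J = q := by
      rw [mul_comm, Nat.mul_add_div hJ0, Nat.div_eq_of_lt hj, add_zero]
    have h2 : (q * J + j) % J = j := by
      rw [mul_comm, Nat.mul_add_mod, Nat.mod_eq_of_lt hj]
    have h3 := hx (q * J + j) (by
      have := Nat.mul_le_mul_right J (Nat.succ_le_of_lt hq)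
      rw [Nat.succ_mul] at this
      omega) t ht
    simp only [h1, h2] at h3
    have h4 := hx' (n₀ + q * K + (r q + j * P + g) + t) (by
      have e1 := Nat.mul_le_mul_right K (Nat.succ_le_of_lt hq)
      rw [Nat.succ_mul] at e1
      have e2 := Nat.mul_le_mul_right P (Nat.succ_le_of_lt hj)
      rw [Nat.succ_mul] at e2
      have e3 : K = J * P + P := by rw [hK]; ring
      have := hr q
      omega)
    have := dist_triangle (T^[t] (z q j)) (T^[n₀ + q * K + (r q + j * P + g) + t] x)
      (T^[n₀ + q * K + (r q + j * P + g) + t] x')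
    linarith
  have hwaste : (J * g + (g + L)) * B ≤ 2 * B * θ * K := by
    have : (J * g + (g + L) : ℝ) ≤ 2 * θ * K := by linarith
    have := mul_le_mul_of_nonneg_right this hB0.le
    linarith
  constructor
  · obtain ⟨m, hm⟩ := Nat.exists_eq_add_of_le hnQ
    have hmK : m ≤ K := by omega
    set f : ℕ → E := fun i => F (T^[i] x', S^[i] y) with hf
    have hfB : ∀ i, ‖f i‖ ≤ B := fun i => hFB _
    have h1 := norm_sum_windows_sub_le hfB Q J g L n₀ hr
    have h2 : ‖(∑ q ∈ Finset.range Q, ∑ j ∈ Finset.range J, ∑ t ∈ Finset.range L,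
        f (n₀ + q * K + (r q + j * P + g) + t)) - s‖ ≤ Q * (J * (L * (η / 8))) := by
      rw [hs]
      simp only [← Finset.sum_sub_distrib]
      have aux : ∀ (m : ℕ) (b : ℝ) (u : ℕ → E), (∀ i < m, ‖u i‖ ≤ b) →
          ‖∑ i ∈ Finset.range m, u i‖ ≤ m * b := fun m b u hu => by
        simpa using norm_sum_le_of_le (Finset.range m) fun i hi => hu i (Finset.mem_range.1 hi)
      refine aux Q _ _ fun q hq => aux J _ _ fun j hj => aux L _ _ fun t ht => ?_
      refine hFε _ _ ?_
      rw [Prod.dist_eq, dist_self, dist_comm]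
      exact max_lt (hshadow q hq j hj t ht) (by positivity)
    rw [hm, Finset.sum_range_add, Finset.sum_range_add, ← hm]
    have h3 := norm_sum_range_le n₀ hfB
    have h4 := norm_sum_range_le (h := fun i => f (n₀ + Q * K + i)) m fun i => hfB _
    have h5 : (m : ℝ) * B ≤ K * B := by gcongr
    have h6 : (Q * (J * (L * (η / 8))) : ℝ) ≤ n * (η / 8) := by
      have : (Q * (J * L) : ℝ) ≤ Q * K := by gcongr
      have := mul_le_mul_of_nonneg_right (this.trans hQK) (show 0 ≤ η / 8 by positivity)
      linarith
    have h7 : (Q * ((J * g + (g + L)) * B) : ℝ) ≤ 2 * B * θ * n := by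
      have := mul_le_mul_of_nonneg_left hwaste (Nat.cast_nonneg (α := ℝ) Q)
      have h8 : 2 * B * θ * (Q * K) ≤ 2 * B * θ * n := by gcongr
      linarith
    have h8 : (n₀ : ℝ) * B + K * B ≤ B * θ * n := by
      have := mul_le_mul_of_nonneg_left hnθ hB0.le
      linarith
    have h9 : 3 * B * θ * n ≤ η / 8 * n := by
      have : 0 ≤ B * θ := by positivity
      have : 3 * B * θ ≤ η / 8 := by linarith
      gcongr
    set u := ∑ q ∈ Finset.range Q, ∑ j ∈ Finset.range J, ∑ t ∈ Finset.range L,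
        f (n₀ + q * K + (r q + j * P + g) + t) with hu
    have h10 : ‖∑ i ∈ Finset.range (Q * K), f (n₀ + i)‖ ≤
        ‖∑ i ∈ Finset.range (Q * K), f (n₀ + i) - u‖ + (‖u - s‖ + ‖s‖) :=
      (norm_le_norm_sub_add _ u).trans (by gcongr; exact norm_le_norm_sub_add _ _)
    have h11 := norm_add₃_le (a := ∑ i ∈ Finset.range n₀, f i)
      (b := ∑ i ∈ Finset.range (Q * K), f (n₀ + i))
      (c := ∑ i ∈ Finset.range m, f (n₀ + Q * K + i))
    have h12 : 0 < η * n := by positivity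
    change ‖∑ i ∈ Finset.range n₀, f i + ∑ i ∈ Finset.range (Q * K), f (n₀ + i) +
      ∑ i ∈ Finset.range m, f (n₀ + Q * K + i)‖ ≤ η * n
    linarith
  · intro m hm
    set q₀ := m / K with hq₀
    have hdm' := Nat.div_add_mod m K
    have hml' := Nat.mod_lt m hK0
    rw [← hq₀, mul_comm] at hdm'
    have hq₀Q : q₀ ≤ Q := Nat.div_le_div_right (by omega)
    set f : ℕ → E' := fun i => H (T^[i] x') with hf
    have hfB : ∀ i, ‖f i‖ ≤ B := fun i => hHB _
    have h1 := norm_sum_windows_sub_le hfB q₀ J g L n₀ hr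
    have aux : ∀ (m : ℕ) (b : ℝ) (u : ℕ → E'), (∀ i < m, ‖u i‖ ≤ b) →
        ‖∑ i ∈ Finset.range m, u i‖ ≤ m * b := fun m b u hu => by
      simpa using norm_sum_le_of_le (Finset.range m) fun i hi => hu i (Finset.mem_range.1 hi)
    have h2 : ‖∑ q ∈ Finset.range q₀, ∑ j ∈ Finset.range J, ∑ t ∈ Finset.range L,
        f (n₀ + q * K + (r q + j * P + g) + t)‖ ≤ q₀ * (J * (L * (η / 8) + θ * L)) := by
      refine aux q₀ _ _ fun q hq => aux J _ _ fun j hj => ?_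
      refine (norm_le_norm_sub_add _ (∑ t ∈ Finset.range L, H (T^[t] (z q j)))).trans ?_
      refine add_le_add ?_ (hzG q j)
      rw [← Finset.sum_sub_distrib]
      refine aux L _ _ fun t ht => hHε _ _ ?_
      rw [dist_comm]
      exact hshadow q (hq.trans_le hq₀Q) j hj t ht
    rw [← hdm', Finset.sum_range_add, hdm']
    have h4 := norm_sum_range_le (h := fun i => f (n₀ + (q₀ * K + i))) (m % K) fun i => hfB _
    have h5 : ((m % K : ℕ) : ℝ) * B ≤ K * B := by gcongr
    have hqm : (q₀ * K : ℝ) ≤ m := by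
      have : q₀ * K ≤ m := by omega
      exact_mod_cast this
    have h6 : (q₀ * (J * (L * (η / 8) + θ * L)) : ℝ) ≤ (η / 8 + θ) * m := by
      have : (q₀ * (J * L) : ℝ) ≤ q₀ * K := by gcongr
      have h : (q₀ * (J * L) : ℝ) ≤ m := this.trans hqm
      have : (η / 8 + θ) * (q₀ * (J * L)) ≤ (η / 8 + θ) * m := by gcongr
      linarith
    have h7 : (q₀ * ((J * g + (g + L)) * B) : ℝ) ≤ 2 * B * θ * m := by
      have := mul_le_mul_of_nonneg_left hwaste (Nat.cast_nonneg (α := ℝ) q₀)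
      have h8 : 2 * B * θ * (q₀ * K) ≤ 2 * B * θ * m := by gcongr
      linarith
    have h9 : (η / 8 + θ + 2 * B * θ) * m ≤ η * m := by
      have : θ ≤ B * θ := le_mul_of_one_le_left hθ0.le hB1
      have : 0 ≤ B * θ := by positivity
      have : η / 8 + θ + 2 * B * θ ≤ η := by linarith
      gcongr
    have h10 := norm_le_norm_sub_add (∑ i ∈ Finset.range (q₀ * K), f (n₀ + i))
      (∑ q ∈ Finset.range q₀, ∑ j ∈ Finset.range J, ∑ t ∈ Finset.range L,
        f (n₀ + q * K + (r q + j * P + g) + t))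
    have h11 := norm_add_le (∑ i ∈ Finset.range (q₀ * K), f (n₀ + i))
      (∑ i ∈ Finset.range (m % K), f (n₀ + (q₀ * K + i)))
    change ‖∑ i ∈ Finset.range (q₀ * K), f (n₀ + i) +
      ∑ i ∈ Finset.range (m % K), f (n₀ + (q₀ * K + i))‖ ≤ η * m + K₀
    linarith

/-! ### Countably many test functions and convergence of averages. -/

theorem tendsto_of_denseRange {Z ι : Type*} [TopologicalSpace Z] [CompactSpace Z]
    [MeasurableSpace Z] [OpensMeasurableSpace Z] {f : ℕ → C(Z, ℝ)} (hf : DenseRange f)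
    {l : Filter ι} {P : ι → ProbabilityMeasure Z} {R : ProbabilityMeasure Z}
    (h : ∀ i, Tendsto (fun n => ∫ z, f i z ∂(P n : Measure Z)) l
      (𝓝 (∫ z, f i z ∂(R : Measure Z)))) : Tendsto P l (𝓝 R) := by
  have hclose : ∀ (m : ProbabilityMeasure Z) (u v : C(Z, ℝ)) (e : ℝ), dist u v ≤ e →
      dist (∫ z, u z ∂(m : Measure Z)) (∫ z, v z ∂(m : Measure Z)) ≤ e := by
    intro m u v e huv
    rw [dist_eq_norm, ← integral_sub (continuous_integrable u.continuous)
      (continuous_integrable v.continuous)]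
    refine (norm_integral_le_of_norm_le_const (C := e) (ae_of_all _ fun z => ?_)).trans ?_
    · rw [← dist_eq_norm]
      exact (ContinuousMap.dist_apply_le_dist z).trans huv
    · simp
  rw [ProbabilityMeasure.tendsto_iff_forall_integral_tendsto]
  intro φ
  rw [Metric.tendsto_nhds]
  intro ε hε
  obtain ⟨i, hi⟩ := hf.exists_dist_lt φ.toContinuousMap (show 0 < ε / 3 by positivity)
  filter_upwards [Metric.tendsto_nhds.1 (h i) (ε / 3) (by positivity)] with n hn
  have h1 := hclose (P n) φ.toContinuousMap (f i) _ hi.le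
  have h2 := hclose R φ.toContinuousMap (f i) _ hi.le
  rw [dist_comm] at h2
  have h3 := dist_triangle4 (∫ z, φ.toContinuousMap z ∂(P n : Measure Z))
    (∫ z, f i z ∂(P n : Measure Z)) (∫ z, f i z ∂(R : Measure Z))
    (∫ z, φ.toContinuousMap z ∂(R : Measure Z))
  change dist (∫ z, φ.toContinuousMap z ∂(P n : Measure Z))
    (∫ z, φ.toContinuousMap z ∂(R : Measure Z)) < ε
  linarith

/-- Bundling the first `k + 1` test functions into one Euclidean vector lets a single Hilbert-space
selection treat them together. -/
theorem exists_centered_vector {Z : Type*} [TopologicalSpace Z] [CompactSpace Z]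
    [MeasurableSpace Z] [OpensMeasurableSpace Z] (R : ProbabilityMeasure Z)
    (f : ℕ → C(Z, ℝ)) (k : ℕ) :
    ∃ F : C(Z, EuclideanSpace ℝ (Fin (k + 1))), ∫ z, F z ∂(R : Measure Z) = 0 ∧
      ∀ i ≤ k, ∀ (n : ℕ) (p : ℕ → Z),
        |∑ j ∈ Finset.range n, (f i (p j) - ∫ z, f i z ∂(R : Measure Z))|
          ≤ ‖∑ j ∈ Finset.range n, F (p j)‖ := by
  let F : C(Z, EuclideanSpace ℝ (Fin (k + 1))) :=
    ⟨fun z => WithLp.toLp 2 fun i : Fin (k + 1) => f i z - ∫ z, f i z ∂(R : Measure Z), by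
      fun_prop⟩
  refine ⟨F, ?_, fun i hi n p => ?_⟩
  · ext i
    let π : EuclideanSpace ℝ (Fin (k + 1)) →L[ℝ] ℝ := EuclideanSpace.proj i
    have h1 := π.integral_comp_comm
      (μ := (R : Measure Z)) (continuous_integrable F.continuous)
    have h2 : ∀ z, π (F z)
      = f i z - ∫ z, f i z ∂(R : Measure Z) := fun z => rfl
    simp only [h2] at h1
    rw [integral_sub (continuous_integrable (f i).continuous) (integrable_const _)] at h1
    simpa [π] using h1.symm
  · have h1 := PiLp.norm_apply_le (p := 2) (∑ j ∈ Finset.range n, F (p j))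
      (⟨i, by omega⟩ : Fin (k + 1))
    rw [WithLp.ofLp_sum, Finset.sum_apply] at h1
    exact h1

/-- For `N` between `n (k + 1)` and `n (k + 2)`, the part before `n k` is negligible by growth, and
stages `k` and `k + 1` control the rest. The overhead `K (k + 1)` is paid as soon as stage `k + 1`
begins, so `n (k + 1)` must already dominate it. -/
theorem tendsto_average_zero {a : ℕ → ℝ} {B : ℝ} (hB : ∀ j, ‖a j‖ ≤ B) {n K : ℕ → ℕ}
    (hn : StrictMono n) (hgrow : ∀ k, (k + 1) * (n k + K k + K (k + 1)) ≤ n (k + 1)) {i₀ : ℕ}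
    (h : ∀ k ≥ i₀, ∀ m, n k + m ≤ n (k + 1) →
      |∑ j ∈ Finset.range m, a (n k + j)| ≤ 1 / ((k : ℝ) + 1) * m + K k) :
    Tendsto (fun N : ℕ => (N : ℝ)⁻¹ * ∑ j ∈ Finset.range N, a j) atTop (𝓝 0) := by
  have hB0 : 0 ≤ B := (norm_nonneg _).trans (hB 0)
  have hg : ∀ k : ℕ, ((k : ℝ) + 1) * (n k + K k + K (k + 1)) ≤ n (k + 1) := fun k => by
    exact_mod_cast hgrow k
  have hsplit : ∀ k ≥ i₀, ∀ N, n k ≤ N → N ≤ n (k + 1) →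
      |∑ j ∈ Finset.range N, a j| ≤
        |∑ j ∈ Finset.range (n k), a j| + 1 / ((k : ℝ) + 1) * N + K k := by
    intro k hk N hN hN'
    obtain ⟨m, rfl⟩ := Nat.exists_eq_add_of_le hN
    rw [Finset.sum_range_add]
    have h1 := h k hk m hN'
    have h2 := abs_add_le (∑ j ∈ Finset.range (n k), a j) (∑ j ∈ Finset.range m, a (n k + j))
    have h3 : 1 / ((k : ℝ) + 1) * m ≤ 1 / ((k : ℝ) + 1) * (n k + m : ℕ) := by
      gcongr; omega
    linarith
  have hend : ∀ k ≥ i₀, ((k : ℝ) + 1) * |∑ j ∈ Finset.range (n (k + 1)), a j|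
      ≤ (B + 2) * n (k + 1) := by
    intro k hk
    have h1 := hsplit k hk (n (k + 1)) (hn (Nat.lt_succ_self k)).le le_rfl
    have h2 := norm_sum_range_le (n k) hB
    rw [Real.norm_eq_abs] at h2
    have hk1 : (0 : ℝ) < (k : ℝ) + 1 := by positivity
    have h3 : |∑ j ∈ Finset.range (n (k + 1)), a j| ≤
      n k * B + 1 / ((k : ℝ) + 1) * n (k + 1) + K k := by linarith
    have h4 := mul_le_mul_of_nonneg_left h3 hk1.le
    have h5 : ((k : ℝ) + 1) * (n k * B + 1 / ((k : ℝ) + 1) * n (k + 1) + K k)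
      = B * ((k + 1) * n k) + n (k + 1) + (k + 1) * K k := by field_simp
    have h6 : ((k : ℝ) + 1) * n k ≤ n (k + 1) := by
      have : (0 : ℝ) ≤ (k + 1) * (K k + K (k + 1)) := by positivity
      linarith [hg k]
    have h7 : ((k : ℝ) + 1) * K k ≤ n (k + 1) := by
      have : (0 : ℝ) ≤ (k + 1) * (n k + K (k + 1)) := by positivity
      linarith [hg k]
    have h8 := mul_le_mul_of_nonneg_left h6 hB0
    linarith
  have hall : ∀ k ≥ i₀, ∀ N, n (k + 1) ≤ N → N ≤ n (k + 2) →
      ((k : ℝ) + 1) * |∑ j ∈ Finset.range N, a j| ≤ (B + 4) * N := by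
    intro k hk N hN hN'
    have h1 := hsplit (k + 1) (by omega) N hN hN'
    have hk1 : (0 : ℝ) < (k : ℝ) + 1 := by positivity
    have h2 := mul_le_mul_of_nonneg_left h1 hk1.le
    have h3 := hend k hk
    have hNr : (n (k + 1) : ℝ) ≤ N := by exact_mod_cast hN
    have h4 : ((k : ℝ) + 1) * (1 / (((k + 1 : ℕ) : ℝ) + 1) * N) ≤ N := by
      rw [← mul_assoc, mul_one_div]
      refine mul_le_of_le_one_left (by positivity) ?_
      rw [div_le_one (by positivity)]
      push_cast; linarith
    have h7 : ((k : ℝ) + 1) * K (k + 1) ≤ n (k + 1) := by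
      have : (0 : ℝ) ≤ (k + 1) * (n k + K k) := by positivity
      linarith [hg k]
    have h8 : (B + 2) * n (k + 1) ≤ (B + 2) * N := by gcongr
    linarith
  rw [Metric.tendsto_atTop]
  intro ε hε
  obtain ⟨k₀, hk₀⟩ := exists_nat_gt ((B + 4) / ε)
  set k₁ := max k₀ i₀ with hk₁
  refine ⟨n (k₁ + 1) + 1, fun N hN => ?_⟩
  have hex : ∃ l, N < n (k₁ + l + 2) := ⟨N, by
    have := hn.le_apply (x := k₁ + N + 2); omega⟩
  classical
  set l := Nat.find hex with hl
  have hl1 : N < n (k₁ + l + 2) := Nat.find_spec hex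
  have hl2 : n (k₁ + l + 1) ≤ N := by
    rcases Nat.eq_zero_or_pos l with h0 | h0
    · rw [h0]; simp only [add_zero]; omega
    · have := Nat.find_min hex (m := l - 1) (by omega)
      rw [not_lt] at this
      have e : k₁ + (l - 1) + 2 = k₁ + l + 1 := by omega
      rwa [e] at this
  have h1 := hall (k₁ + l) (by omega) N hl2 hl1.le
  have hN0 : (0 : ℝ) < N := by
    have : 0 < N := by omega
    exact_mod_cast this
  rw [dist_zero_right, Real.norm_eq_abs, abs_mul, abs_inv, Nat.abs_cast, inv_mul_lt_iff₀ hN0]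
  have h2 : (k₀ : ℝ) ≤ ((k₁ + l : ℕ) : ℝ) := by
    have : k₀ ≤ k₁ + l := by omega
    exact_mod_cast this
  rw [div_lt_iff₀ hε] at hk₀
  have hpos : (0 : ℝ) < ((k₁ + l : ℕ) : ℝ) + 1 := by positivity
  have h3 : (B + 4) * N < (((k₁ + l : ℕ) : ℝ) + 1) * (N * ε) := by
    have h4 : (B + 4) * N < k₀ * ε * N := mul_lt_mul_of_pos_right hk₀ hN0
    have h5 : k₀ * (ε * N) ≤ ((k₁ + l : ℕ) : ℝ) * (ε * N) := by gcongr
    have h6 : 0 < ε * N := by positivity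
    linarith
  exact lt_of_mul_lt_mul_left (h1.trans_lt h3) hpos.le

theorem integral_empiricalMeasure_sub {X : Type*} [MeasurableSpace X] (T : X → X) (x : X) (n : ℕ)
    {f : X → ℝ} (hf : StronglyMeasurable f) (c : ℝ) :
    ∫ a, f a ∂(empiricalMeasure T x n : Measure X) - c
      = ((n + 1 : ℕ) : ℝ)⁻¹ * ∑ i ∈ Finset.range (n + 1), (f (T^[i] x) - c) := by
  rw [integral_empiricalMeasure T x n hf, Finset.sum_sub_distrib, Finset.sum_const,
    Finset.card_range, nsmul_eq_mul, mul_sub, ← mul_assoc, inv_mul_cancel₀ (by positivity), one_mul]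
  push_cast
  rfl

/-! ### Iterating the stages and passing to the limit. -/

/-- The order of quantifiers matters: `d` depends on `k` alone and `K₀` only on `ε` besides, so all
tolerances and all overheads can be fixed before any orbit segment is chosen. -/
theorem exists_stage
    {X Y : Type*}
    [MetricSpace X] [CompactSpace X] [MeasurableSpace X] [BorelSpace X]
    [MetricSpace Y] [CompactSpace Y] [MeasurableSpace Y] [BorelSpace Y]
    {T : X → X} (hT : Continuous T) (hTsurj : Function.Surjective T)
    {S : Y → Y} (hS : Continuous S)
    {ξ : ProbabilityMeasure (X × Y)} {μ : ProbabilityMeasure X} {ν : ProbabilityMeasure Y}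
    (hξ : MeasurePreserving (Prod.map T S) (ξ : Measure (X × Y)) (ξ : Measure (X × Y)))
    (hξμ : (ξ : Measure (X × Y)).map Prod.fst = (μ : Measure X))
    (hξν : (ξ : Measure (X × Y)).map Prod.snd = (ν : Measure Y))
    (hspec : WeakSpecification T) (hμ : Ergodic T (μ : Measure X))
    {y : Y} (hy : IsQuasiGeneric S y ν) (F : ℕ → C(X × Y, ℝ)) (H : ℕ → C(X, ℝ)) (k : ℕ) :
    ∃ d > 0, ∀ ε, 0 < ε → ε ≤ d →
    ∃ K₀ : ℕ, ∀ (N : ℕ) (x₀ : X) (n₀ : ℕ), 0 < n₀ → ∃ (x : X) (n : ℕ), N ≤ n ∧ n₀ ≤ n ∧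
      (∀ i < n₀, dist (T^[i] x₀) (T^[i] x) < ε) ∧
      ∀ x', (∀ i < n, dist (T^[i] x) (T^[i] x') ≤ ε) →
        (∀ i ≤ k, |∑ j ∈ Finset.range n, (F i (T^[j] x', S^[j] y) -
            ∫ p, F i p ∂(ξ : Measure (X × Y)))| ≤ 1 / ((k : ℝ) + 1) * n) ∧
        ∀ i ≤ k, ∀ m, n₀ + m ≤ n →
          |∑ j ∈ Finset.range m, (H i (T^[n₀ + j] x') - ∫ p, H i p ∂(μ : Measure X))| ≤
            1 / ((k : ℝ) + 1) * m + K₀ := by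
  obtain ⟨Fv, hFv, hFv'⟩ := exists_centered_vector ξ F k
  obtain ⟨Hv, hHv, hHv'⟩ := exists_centered_vector μ H k
  have hη : (0 : ℝ) < 1 / ((k : ℝ) + 1) := by positivity
  have hη1 : 1 / ((k : ℝ) + 1) ≤ 1 := by
    rw [div_le_one (by positivity)]; linarith [Nat.cast_nonneg (α := ℝ) k]
  obtain ⟨d₁, hd₁, hFd⟩ := Metric.uniformContinuous_iff.1
    (CompactSpace.uniformContinuous_of_continuous Fv.continuous) (1 / ((k : ℝ) + 1) / 8)
    (by positivity)
  obtain ⟨d₂, hd₂, hHd⟩ := Metric.uniformContinuous_iff.1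
    (CompactSpace.uniformContinuous_of_continuous Hv.continuous) (1 / ((k : ℝ) + 1) / 8)
    (by positivity)
  refine ⟨min d₁ d₂ / 2, by positivity, fun ε hε hεd => ?_⟩
  have h1 := min_le_left d₁ d₂
  have h2 := min_le_right d₁ d₂
  obtain ⟨K₀, hK₀⟩ := exists_orbit_extension hT hTsurj hS hξ hξμ hξν hspec hμ hy Fv hFv Hv hHv
    hε hη hη1
    (fun p q hpq => by rw [← dist_eq_norm]; exact (hFd (by linarith)).le)
    (fun p q hpq => by rw [← dist_eq_norm]; exact (hHd (by linarith)).le)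
  refine ⟨K₀, fun N x₀ n₀ hn₀ => ?_⟩
  obtain ⟨x, n, hN, hn, hx, h⟩ := hK₀ N x₀ n₀ hn₀
  refine ⟨x, n, hN, hn, hx, fun x' hx' => ⟨fun i hi => ?_, fun i hi m hm => ?_⟩⟩
  · exact (hFv' i hi n fun j => (T^[j] x', S^[j] y)).trans (h x' hx').1
  · exact (hHv' i hi m fun j => T^[n₀ + j] x').trans ((h x' hx').2 m hm)

theorem exists_limit_orbit
    {X Y : Type*}
    [MetricSpace X] [CompactSpace X] [MeasurableSpace X] [BorelSpace X]
    [MetricSpace Y] [CompactSpace Y] [MeasurableSpace Y] [BorelSpace Y]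
    {T : X → X} (hT : Continuous T) (hTsurj : Function.Surjective T)
    {S : Y → Y} (hS : Continuous S)
    {ξ : ProbabilityMeasure (X × Y)} {μ : ProbabilityMeasure X} {ν : ProbabilityMeasure Y}
    (hξ : MeasurePreserving (Prod.map T S) (ξ : Measure (X × Y)) (ξ : Measure (X × Y)))
    (hξμ : (ξ : Measure (X × Y)).map Prod.fst = (μ : Measure X))
    (hξν : (ξ : Measure (X × Y)).map Prod.snd = (ν : Measure Y))
    (hspec : WeakSpecification T) (hμ : Ergodic T (μ : Measure X))
    {y : Y} (hy : IsQuasiGeneric S y ν) (F : ℕ → C(X × Y, ℝ)) (H : ℕ → C(X, ℝ)) :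
    ∃ (x : X) (n K : ℕ → ℕ), StrictMono n ∧
      (∀ k, (k + 1) * (n k + K k + K (k + 1)) ≤ n (k + 1)) ∧
      (∀ k, ∀ i ≤ k, |∑ j ∈ Finset.range (n (k + 1)), (F i (T^[j] x, S^[j] y) -
            ∫ p, F i p ∂(ξ : Measure (X × Y)))| ≤ 1 / ((k : ℝ) + 1) * n (k + 1)) ∧
      ∀ k, ∀ i ≤ k, ∀ m, n k + m ≤ n (k + 1) →
          |∑ j ∈ Finset.range m, (H i (T^[n k + j] x) - ∫ p, H i p ∂(μ : Measure X))| ≤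
            1 / ((k : ℝ) + 1) * m + K k := by
  choose d hd hstage using exists_stage hT hTsurj hS hξ hξμ hξν hspec hμ hy F H
  -- Halving makes the closed tubes `U k` nested: a move below `δ (k + 1)` plus a tube of radius `δ
  -- (k + 1)` fits into radius `δ k`.
  let δ : ℕ → ℝ := fun k => Nat.rec (d 0) (fun k e => min (d (k + 1)) (e / 2)) k
  have hδs : ∀ k, δ (k + 1) = min (d (k + 1)) (δ k / 2) := fun k => rfl
  have hδ0 : ∀ k, 0 < δ k := by
    intro k
    induction k with
    | zero => exact hd 0
    | succ k ih => rw [hδs]; exact lt_min (hd _) (half_pos ih)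
  have hδd : ∀ k, δ k ≤ d k := by
    intro k
    cases k with
    | zero => exact le_rfl
    | succ k => rw [hδs]; exact min_le_left _ _
  have hδhalf : ∀ k, δ (k + 1) ≤ δ k / 2 := fun k => by rw [hδs]; exact min_le_right _ _
  choose K hK using fun k => hstage k (δ k) (hδ0 k) (hδd k)
  have : Nonempty X := (μ : Measure X).nonempty_of_neZero
  obtain x₀ : X := Classical.arbitrary X
  choose! nx nn hnn using fun (k : ℕ) (s : X × ℕ) (hs : 0 < s.2) =>
    hK k (s.2 + 1 + (k + 1) * (s.2 + K k + K (k + 1))) s.1 s.2 hs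
  -- The initial length is `1` because a stage needs a nonempty prefix.
  let st : ℕ → X × ℕ := fun k => Nat.rec (x₀, 1) (fun k s => (nx k s, nn k s)) k
  have hst : ∀ k, st (k + 1) = (nx k (st k), nn k (st k)) := fun k => rfl
  have hst0 : ∀ k, 0 < (st k).2 := by
    intro k
    induction k with
    | zero => exact Nat.one_pos
    | succ k ih =>
      have := (hnn k (st k) ih).1
      rw [hst]
      simp only
      omega
  have key := fun k => hnn k (st k) (hst0 k)
  have key1 : ∀ k, nx k (st k) = (st (k + 1)).1 := fun k => rfl
  have key2 : ∀ k, nn k (st k) = (st (k + 1)).2 := fun k => rfl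
  simp only [key1, key2] at key
  let U : ℕ → Set X := fun k =>
    {x' | ∀ i < (st (k + 1)).2, dist (T^[i] (st (k + 1)).1) (T^[i] x') ≤ δ k}
  have hUclosed : ∀ k, IsClosed (U k) := by
    intro k
    have : U k = ⋂ i, ⋂ _ : i < (st (k + 1)).2,
        {x' | dist (T^[i] (st (k + 1)).1) (T^[i] x') ≤ δ k} := by
      ext x'; simp [U]
    rw [this]
    exact isClosed_iInter fun i => isClosed_iInter fun _ =>
      isClosed_le (continuous_const.dist (hT.iterate i)) continuous_const
  have hUsub : ∀ k, U (k + 1) ⊆ U k := by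
    intro k x' hx' i hi
    obtain ⟨-, hle, hclose, -⟩ := key (k + 1)
    have h1 := hx' i (hi.trans_le hle)
    have h2 := hclose i hi
    have h3 := dist_triangle (T^[i] (st (k + 1)).1) (T^[i] (st (k + 1 + 1)).1) (T^[i] x')
    have h4 := hδhalf k
    linarith
  have hUne : ∀ k, (U k).Nonempty := fun k =>
    ⟨(st (k + 1)).1, fun i _ => by rw [dist_self]; exact (hδ0 k).le⟩
  obtain ⟨x, hx⟩ := IsCompact.nonempty_iInter_of_sequence_nonempty_isCompact_isClosed U hUsub hUne
    (hUclosed 0).isCompact hUclosed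
  rw [Set.mem_iInter] at hx
  refine ⟨x, fun k => (st k).2, K, strictMono_nat_of_lt_succ fun k => ?_, fun k => ?_,
    fun k => ?_, fun k => ?_⟩
  · have := (key k).1; omega
  · exact (Nat.le_add_left _ _).trans (key k).1
  · exact ((key k).2.2.2 x (hx k)).1
  · exact ((key k).2.2.2 x (hx k)).2

end OrbitLift

open OrbitLift in
theorem theorem3
    {X Y : Type*}
    [MetricSpace X] [CompactSpace X] [MeasurableSpace X] [BorelSpace X]
    [MetricSpace Y] [CompactSpace Y] [MeasurableSpace Y] [BorelSpace Y]
    (T : X → X) (hT : Continuous T) (hTsurj : Function.Surjective T)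
    (S : Y → Y) (hS : Continuous S) (hSsurj : Function.Surjective S)
    (ξ : ProbabilityMeasure (X × Y)) (μ : ProbabilityMeasure X) (ν : ProbabilityMeasure Y)
    (hξ : MeasurePreserving (Prod.map T S) (ξ : Measure (X × Y)) (ξ : Measure (X × Y)))
    (hξμ : (ξ : Measure (X × Y)).map Prod.fst = (μ : Measure X))
    (hξν : (ξ : Measure (X × Y)).map Prod.snd = (ν : Measure Y))
    (hspec : OrbitLift.WeakSpecification T)
    (hμ : Ergodic T (μ : Measure X))
    (y : Y) (hy : OrbitLift.IsQuasiGeneric S y ν) :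
    ∃ x : X, OrbitLift.IsGeneric T x μ ∧
      OrbitLift.IsQuasiGeneric (Prod.map T S) (x, y) ξ := by
  obtain ⟨x, n, K, hn, hgrow, hF, hH⟩ := exists_limit_orbit hT hTsurj hS hξ hξμ hξν hspec hμ hy
    (TopologicalSpace.denseSeq C(X × Y, ℝ)) (TopologicalSpace.denseSeq C(X, ℝ))
  refine ⟨x, ?_, ?_⟩
  · refine tendsto_of_denseRange (TopologicalSpace.denseRange_denseSeq C(X, ℝ)) fun i => ?_
    set h := TopologicalSpace.denseSeq C(X, ℝ) i
    have h1 := tendsto_average_zero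
      (a := fun j => h (T^[j] x) - ∫ p, h p ∂(μ : Measure X))
      (B := ‖h‖ + ‖∫ p, h p ∂(μ : Measure X)‖)
      (fun j => (norm_sub_le _ _).trans (by gcongr; exact h.norm_coe_le_norm _)) hn hgrow
      (fun k hk => hH k i hk)
    rw [← tendsto_sub_nhds_zero_iff]
    refine ((tendsto_add_atTop_iff_nat 1).2 h1).congr fun N => ?_
    rw [integral_empiricalMeasure_sub _ _ _ h.continuous.stronglyMeasurable]
  · have hn1 : ∀ k, n (k + 1) - 1 + 1 = n (k + 1) := fun k => by
      have := hn (Nat.lt_succ_self k)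
      simp only [Nat.succ_eq_add_one] at this
      omega
    -- The empirical measure with index `n (k + 1) - 1` averages over exactly `n (k + 1)` points.
    have hsub : Tendsto (fun k => n (k + 1) - 1) atTop atTop :=
      (tendsto_sub_atTop_nat 1).comp (hn.tendsto_atTop.comp (tendsto_add_atTop_nat 1))
    refine MapClusterPt.of_comp hsub (Tendsto.mapClusterPt ?_)
    refine tendsto_of_denseRange (TopologicalSpace.denseRange_denseSeq C(X × Y, ℝ)) fun i => ?_
    set f := TopologicalSpace.denseSeq C(X × Y, ℝ) i
    rw [← tendsto_sub_nhds_zero_iff]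
    refine squeeze_zero_norm' ?_ tendsto_one_div_add_atTop_nhds_zero_nat
    filter_upwards [eventually_ge_atTop i] with k hk
    simp only [Function.comp_apply]
    rw [integral_empiricalMeasure_sub _ _ _ f.continuous.stronglyMeasurable, hn1, norm_mul,
      norm_inv, RCLike.norm_natCast, Real.norm_eq_abs]
    have hpos : (0 : ℝ) < n (k + 1) := by
      have : 0 < n (k + 1) := by have := hn1 k; omega
      exact_mod_cast this
    rw [inv_mul_le_iff₀ hpos, mul_comm]
    have := hF k i hk
    simpa [Prod.map_iterate] using this
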